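/- A \emph{line combinatorics} $(\mathcal L,\mathcal P)$ is a finite set $\mathcal L$ of lines with a set $\mathcal P$ of subsets of $\mathcal L$ (points), each with at least two elements, such that any two distinct lines lie in exactly one common point. For $\mathcal L'\subseteq\mathcal L$ the subcombinatorics on $\mathcal L'$ has as points the sets $p\cap\mathcal L'$ ($p\in\mathcal P$) with more than one element. A \emph{combinatorial pencil} contained in $(\mathcal L,\mathcal P)$ consists of a subcombinatorics $(\mathcal L',\mathcal P')$, a partition of $\mathcal L'$ into nonempty (unordered) fibers, and weights $w:\mathcal L'\to\mathbb Z_{>0}$, such that for each $p\in\mathcal P'$ exactly one of the following holds: (i) $p$ is contained in a fiber; (ii) $p$ meets every fiber, and $\sum_{l\in p\cap F}w(l)$ is the same for all fibers $F$. Two pencils are identified if they have the same lines and fibers and their weights differ by a common positive rational factor. Let $H=\mathbb Z^{\mathcal L}/\langle(1,\dots,1)\rangle$ with generators $e_l$. For $r\ge 2$, an $(r+1)$-\emph{admissible map} is an epimorphism $f:H\to\mathbb Z^{r}$ such that $f(e_l)$ and $\sum_{m\in p}f(e_m)$ are linearly dependent whenever $l\in p\in\mathcal P$; it is \emph{maximal}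 if it is not the composition of an $(r+2)$-admissible map with an epimorphism $\mathbb Z^{r+1}\to\mathbb Z^{r}$. A pencil with $r+1\geq 3$ fibers determines, uniquely up to automorphisms of $\mathbb Z^{r}$, an admissible map $f:H\to\mathbb Z^r$ with $f(e_l)=w(l)\,v_F$ for $l$ in the fiber $F$ and $f(e_l)=0$ for $l\notin\mathcal L'$, where the vectors $v_F\in\mathbb Q^r$ span $\mathbb Q^r$ and have sum zero. The pencil is \emph{maximal} in $(\mathcal L,\mathcal P)$ if this map is maximal. Let $E_1$ be the $\mathbb Q$-vector space generated by $x_l$ ($l\in\mathcal L$) with the relation $\sum_l x_l=0$, let $\delta(x_{l_1}\wedge\cdots\wedge x_{l_m})=\sum_j(-1)^{j-1}x_{l_1}\wedge\cdots\widehat{x_{l_j}}\cdots\wedge x_{l_m}$ (a formula on words), and let $\mathcal A$ be the Orlik--Solomon algebra: the quotient of the exterior algebra of $E_1$ by the ideal generated by $\delta$ of all words of length $>3$, $\delta(x_i\wedge x_j\wedge x_k)$ for distinct concurrent lines, and $x_i\wedge x_j\wedge x_k$ for distinct non-concurrent lines. The resonance variety is $R_1=\{\omega\in\mathcal A_1 :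 H^1(\mathbb Q\xrightarrow{\omega\wedge}\mathcal A_1\xrightarrow{\omega\wedge}\mathcal A_2)\ne0\}$ in $\mathcal A_1=E_1$ with the Zariski topology. \textbf{Theorem.} Let $(\mathcal L,\mathcal P)$ be a line combinatorics and let $k\ge2$. There is a bijection between the maximal combinatorial pencils with $k+1$ fibers contained in $(\mathcal L,\mathcal P)$ (up to rescaling the weights) and the $k$-dimensional irreducible components of $R_1$. It sends a pencil with admissible map $f:H\to\mathbb Z^k$ to the $\mathbb Q$-span in $E_1$ of the rows $\sum_{l}f(e_l)_i\,x_l$, $i=1,\dots,k$. -/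

import Mathlib

/-- A line combinatorics: a finite set of lines, together with a set of points, each point being
the set of the lines through it. Every point lies on at least two lines, and any two
distinct lines meet in exactly one point. -/
structure LineCombinatorics (α : Type*) [DecidableEq α] where
  lines : Finset α
  points : Finset (Finset α)
  point_subset : ∀ p ∈ points, p ⊆ lines
  one_lt_card : ∀ p ∈ points, 1 < p.card
  existsUnique_point : ∀ i ∈ lines, ∀ j ∈ lines, i ≠ j → ∃! p, p ∈ points ∧ i ∈ p ∧ j ∈ p

/-- A combinatorial pencil: a line combinatorics with a partition of its lines into (nonempty,
unordered) fibers and a positive integer weight on each line, such that for each point exactly one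
of the following holds: all lines through it lie in one fiber; or every fiber has a line through
it, and the total weight of the lines through it is the same for all fibers (a base point).
The values of `weight` outside `lines` carry no meaning. -/
structure CombinatorialPencil (α : Type*) [DecidableEq α] extends LineCombinatorics α where
  fibers : Finpartition lines
  weight : α → ℕ
  weight_pos : ∀ l ∈ lines, 0 < weight l
  fiber_or_base : ∀ p ∈ points,
    Xor (∃ F ∈ fibers.parts, p ⊆ F)
      ((∀ F ∈ fibers.parts, (p ∩ F).Nonempty) ∧
        ∀ F ∈ fibers.parts, ∀ G ∈ fibers.parts, ∑ l ∈ p ∩ F, weight l = ∑ l ∈ p ∩ G, weight l)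

namespace LineCombinatorics

variable {α : Type*} [DecidableEq α]

/-- `D` is obtained from `C` by deleting lines: its points are the traces, on the remaining lines,
of the points of `C` that still lie on at least two lines. -/
def IsSubcombinatorics (D C : LineCombinatorics α) : Prop :=
  D.lines ⊆ C.lines ∧
    D.points = (C.points.image fun p => p ∩ D.lines).filter fun q => 1 < q.card

/-! ### Admissible maps -/

/-- The lattice `H`: the quotient of `ℤ ^ lines` by the vector `(1, …, 1)`. -/
abbrev H (C : LineCombinatorics α) : Type _ :=
  (C.lines → ℤ) ⧸ Submodule.span ℤ {(fun _ => 1 : C.lines → ℤ)}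

/-- The canonical generator `e_l` of `H`. -/
def e (C : LineCombinatorics α) (l : C.lines) : C.H :=
  Submodule.Quotient.mk (Pi.single l 1)

/-- A homomorphism `H → ℤ ^ r` is an `(r + 1)`-admissible map, where `2 ≤ r`, if it is onto and,
for each point `p` and each line `l` through `p`, the vectors `f (e_l)` and
`∑_{m through p} f (e_m)` are linearly dependent. -/
def IsAdmissible (C : LineCombinatorics α) {r : ℕ} (f : C.H →ₗ[ℤ] (Fin r → ℤ)) : Prop :=
  2 ≤ r ∧ Function.Surjective f ∧
    ∀ p ∈ C.points, ∀ l : C.lines, (l : α) ∈ p →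
      ¬ LinearIndependent ℤ
        ![f (C.e l), ∑ m ∈ Finset.univ.filter (fun m : C.lines => (m : α) ∈ p), f (C.e m)]

/-- An `(r + 1)`-admissible map is maximal if it is not an `(r + 2)`-admissible map followed by an
epimorphism `ℤ ^ (r + 1) → ℤ ^ r`. -/
def IsMaximalAdmissible (C : LineCombinatorics α) {r : ℕ} (f : C.H →ₗ[ℤ] (Fin r → ℤ)) : Prop :=
  C.IsAdmissible f ∧
    ¬ ∃ (g : C.H →ₗ[ℤ] (Fin (r + 1) → ℤ)) (π : (Fin (r + 1) → ℤ) →ₗ[ℤ] (Fin r → ℤ)),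
      C.IsAdmissible g ∧ Function.Surjective π ∧ f = π ∘ₗ g

/-! ### The Orlik-Solomon algebra over `ℚ` -/

/-- The degree one part: the `ℚ`-vector space generated by the lines, with the relation that the
sum of all lines is zero. -/
abbrev E₁ (C : LineCombinatorics α) : Type _ :=
  (C.lines → ℚ) ⧸ Submodule.span ℚ {(fun _ => 1 : C.lines → ℚ)}

/-- The generator `x_l` of the degree one part. -/
def x (C : LineCombinatorics α) (l : C.lines) : C.E₁ :=
  Submodule.Quotient.mk (Pi.single l 1)

/-- The exterior product `x_{i₁} ∧ ⋯ ∧ x_{iₚ}` attached to a word in the lines. -/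
noncomputable def wordProd (C : LineCombinatorics α) (s : List C.lines) : ExteriorAlgebra ℚ C.E₁ :=
  (s.map fun l => ExteriorAlgebra.ι ℚ (C.x l)).prod

/-- The formal boundary `δ (x_{i₁} ∧ ⋯ ∧ x_{iₚ})` of a word: the alternating sum of the
products of the words obtained by leaving out one letter. -/
noncomputable def wordBoundary (C : LineCombinatorics α) (s : List C.lines) :
    ExteriorAlgebra ℚ C.E₁ :=
  ∑ j : Fin s.length, (-1 : ℚ) ^ (j : ℕ) • C.wordProd (s.eraseIdx j)

/-- The generators of the Orlik-Solomon ideal. -/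
def osRelations (C : LineCombinatorics α) : Set (ExteriorAlgebra ℚ C.E₁) :=
  {z | ∃ s : List C.lines, 3 < s.length ∧ z = C.wordBoundary s} ∪
  {z | ∃ i j k : C.lines, i ≠ j ∧ i ≠ k ∧ j ≠ k ∧
      (∃ p ∈ C.points, (i : α) ∈ p ∧ (j : α) ∈ p ∧ (k : α) ∈ p) ∧ z = C.wordBoundary [i, j, k]} ∪
  {z | ∃ i j k : C.lines, i ≠ j ∧ i ≠ k ∧ j ≠ k ∧
      (¬ ∃ p ∈ C.points, (i : α) ∈ p ∧ (j : α) ∈ p ∧ (k : α) ∈ p) ∧ z = C.wordProd [i, j, k]}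

/-- The Orlik-Solomon algebra over `ℚ`. -/
abbrev OrlikSolomon (C : LineCombinatorics α) : Type _ :=
  (TwoSidedIdeal.span C.osRelations).ringCon.Quotient

/-- The map from degree one to the Orlik-Solomon algebra. -/
noncomputable def osι (C : LineCombinatorics α) : C.E₁ →ₗ[ℚ] C.OrlikSolomon where
  toFun v := (TwoSidedIdeal.span C.osRelations).ringCon.mk' (ExteriorAlgebra.ι ℚ v)
  map_add' v w := by rw [map_add, map_add]
  map_smul' c v := by rw [map_smul]; rfl

/-! ### The resonance variety -/

/-- Multiplication by `ω` from degree zero to degree one. -/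
noncomputable def dZero (C : LineCombinatorics α) (ω : C.E₁) : ℚ →ₗ[ℚ] C.E₁ :=
  LinearMap.toSpanSingleton ℚ C.E₁ ω

/-- Left multiplication by `ω` from degree one, with values in the Orlik-Solomon algebra. -/
noncomputable def dOne (C : LineCombinatorics α) (ω : C.E₁) : C.E₁ →ₗ[ℚ] C.OrlikSolomon :=
  LinearMap.mulLeft ℚ (C.osι ω) ∘ₗ C.osι

theorem dOne_comp_dZero (C : LineCombinatorics α) (ω : C.E₁) : C.dOne ω ∘ₗ C.dZero ω = 0 := by
  ext
  have h : C.osι ω * C.osι ω = 0 := by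
    change (TwoSidedIdeal.span C.osRelations).ringCon.mk' (ExteriorAlgebra.ι ℚ ω) *
      (TwoSidedIdeal.span C.osRelations).ringCon.mk' (ExteriorAlgebra.ι ℚ ω) = 0
    rw [← map_mul, ExteriorAlgebra.ι_sq_zero, map_zero]
  simpa [dOne, dZero] using h

/-- The cohomology in degree one of multiplication by `ω`. -/
abbrev HOne (C : LineCombinatorics α) (ω : C.E₁) : Type _ :=
  LinearMap.ker (C.dOne ω) ⧸
    Submodule.comap (LinearMap.ker (C.dOne ω)).subtype (LinearMap.range (C.dZero ω))

/-- The resonance variety. -/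
def resonanceVariety (C : LineCombinatorics α) : Set C.E₁ :=
  {ω | Nontrivial (C.HOne ω)}

end LineCombinatorics

/-! ### Zariski topology of a finite dimensional vector space -/

/-- The algebra of polynomial functions on a vector space, generated by the linear functionals. -/
def zariskiPolynomials (K V : Type*) [Field K] [AddCommGroup V] [Module K V] :
    Subalgebra K (V → K) :=
  Algebra.adjoin K {f | ∃ φ : Module.Dual K V, f = fun v => φ v}

/-- The Zariski topology: the closed sets are the common zero sets of families of polynomial
functions, so the non-vanishing loci of polynomial functions form a basis of open sets. -/
@[reducible]
def zariskiTopology (K V : Type*) [Field K] [AddCommGroup V] [Module K V] : TopologicalSpace V :=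
  TopologicalSpace.generateFrom {U | ∃ f ∈ zariskiPolynomials K V, U = {v | f v ≠ 0}}

/-- `Z` is an irreducible component of `R`: a maximal irreducible subset, for the Zariski
topology. -/
def IsZariskiComponent (K : Type*) {V : Type*} [Field K] [AddCommGroup V] [Module K V]
    (R Z : Set V) : Prop :=
  Maximal (fun Y : Set V => Y ⊆ R ∧ @IsIrreducible V (zariskiTopology K V) Y) Z

/-- The Krull dimension of a subset for the Zariski topology. -/
noncomputable def zariskiDim (K : Type*) {V : Type*} [Field K] [AddCommGroup V] [Module K V]
    (Z : Set V) : WithBot ℕ∞ :=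
  @topologicalKrullDim Z ((zariskiTopology K V).induced Subtype.val)

namespace LineCombinatorics

variable {α : Type*} [DecidableEq α]

/-- The `k`-dimensional irreducible components of the resonance variety. -/
def ResonanceComponent (C : LineCombinatorics α) (k : ℕ) : Type _ :=
  {Z : Set C.E₁ // IsZariskiComponent ℚ C.resonanceVariety Z ∧ zariskiDim ℚ Z = k}

/-- The span in degree one of the rows `∑_l (f (e_l))_i x_l` of the matrix whose columns are the
vectors `f (e_l)`. -/
def rowSpace (C : LineCombinatorics α) {r : ℕ} (f : C.H →ₗ[ℤ] (Fin r → ℤ)) :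
    Submodule ℚ C.E₁ :=
  Submodule.span ℚ (Set.range fun i : Fin r => ∑ l : C.lines, (f (C.e l) i : ℚ) • C.x l)

/-- The homomorphism `f : H → ℤ ^ r` is one determined by the pencil `P` with `r + 1` fibers:
`f` is onto, `f (e_l) = w(l) v_F` for each line `l` of each fiber `F`, and `f (e_l) = 0` for the
lines outside `P`, where the vectors `v_F` have sum zero. As `f` is onto, the `v_F` span `ℚ ^ r`,
so any `r` of them form a basis; they are taken in `ℚ ^ r`, not in `ℤ ^ r`, because weights with
common factors in a fiber would otherwise prevent `f` from being onto. -/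
def IsDeterminedBy (C : LineCombinatorics α) {r : ℕ} (f : C.H →ₗ[ℤ] (Fin r → ℤ))
    (P : CombinatorialPencil α) : Prop :=
  P.fibers.parts.card = r + 1 ∧ Function.Surjective f ∧
    ∃ v : Finset α → (Fin r → ℚ),
      ∑ F ∈ P.fibers.parts, v F = 0 ∧
      (∀ F ∈ P.fibers.parts, ∀ l : C.lines, (l : α) ∈ F →
        ∀ i, (f (C.e l) i : ℚ) = (P.weight l : ℚ) * v F i) ∧
      ∀ l : C.lines, (l : α) ∉ P.lines → f (C.e l) = 0

/-- The combinatorial pencils with `r + 1` fibers contained in `C` that are maximal in `C`, which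
means that the admissible map (unique up to automorphisms of `ℤ ^ r`) that they determine is
maximal. -/
def MaximalPencil (C : LineCombinatorics α) (r : ℕ) : Type _ :=
  {P : CombinatorialPencil α // P.toLineCombinatorics.IsSubcombinatorics C ∧
    ∃ f : C.H →ₗ[ℤ] (Fin r → ℤ), C.IsDeterminedBy f P ∧ C.IsMaximalAdmissible f}

/-- Two pencils in `C` are identified if they have the same lines and the same fibers, and if
their weights differ by a common positive rational factor. -/
def pencilSetoid (C : LineCombinatorics α) (r : ℕ) : Setoid (C.MaximalPencil r) where
  r P Q := P.1.lines = Q.1.lines ∧ P.1.fibers.parts = Q.1.fibers.parts ∧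
    ∃ c : ℚ, 0 < c ∧ ∀ l ∈ P.1.lines, (P.1.weight l : ℚ) = c * Q.1.weight l
  iseqv :=
    { refl := fun P => ⟨rfl, rfl, 1, one_pos, fun l _ => (one_mul _).symm⟩
      symm := by
        rintro P Q ⟨h1, h2, c, hc, h⟩
        refine ⟨h1.symm, h2.symm, c⁻¹, inv_pos.mpr hc, fun l hl => ?_⟩
        rw [h l (h1 ▸ hl), inv_mul_cancel_left₀ hc.ne']
      trans := by
        rintro P Q R ⟨h1, h2, c, hc, h⟩ ⟨h1', h2', c', hc', h'⟩
        refine ⟨h1.trans h1', h2.trans h2', c * c', mul_pos hc hc', fun l hl => ?_⟩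
        rw [h l hl, h' l (h1 ▸ hl), mul_assoc] }

end LineCombinatorics

/-!
The proof translates both sides of the bijection into isotropic subspaces of the degree one part
`E₁`: subspaces on which all products in the Orlik-Solomon algebra vanish.

An element of `E₁` has a unique representative `a` with sum zero (`coord`). Two elements have
product zero if and only if, at each point `p` and each line `l` through `p`, one has
`a_l b(p) = b_l a(p)`, where `a(p)` is the sum of `a` over `p` (`osι_mul_osι_eq_zero_iff`). One
direction is a computation with the relations; for the other, the pair of functionals `a_l`, `a(p)`
maps the exterior algebra of `E₁` to that of a plane and kills the relations. This local condition
is also the one in the definition of an admissible map, so that a surjective `f : H → ℤ ^ r` with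
`2 ≤ r` is admissible if and only if its row space is isotropic, and maximal if and only if the row
space is maximal isotropic (`isMaximalAdmissible_iff`); every subspace is such a row space.

The core is the classification of an isotropic subspace `W` of dimension at least two. Let `S` be
the support of `W`, let `X` be the set of points at which `W` has rank at least two, and let `M` be
the incidence matrix of `X`. All elements of `W` are in the kernel of `M` and have sum zero, hence
are in the kernel of `MᵀM - J`, where all entries of `J` are one; this matrix has nonpositive
entries off the diagonal. Split `S` into the blocks (connected components) of this matrix; there are at
least two. Take `a` in `W` without zeros on `S`. The quadratic form of `MᵀM - J` is nonpositive at
the restriction of `|a|` to each block, whereas it is equal to `|Mz|²` at any `z` with sum zero.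
Hence the combination with sum zero of the restrictions of `|a|` to two blocks is in the kernel of
`M` (`mul_abs_mem_pointKernel`), and by a minimum principle the elements of the kernel are
proportional to `|a|` on each block (`mul_eq_mul_of_quadRow_eq_zero`). So `|a|`, normalized on each
block, is the weight of a pencil whose fibers are the blocks and whose base points are in `X`
(`exists_block_weight`), and the space of all its block-wise multiples with sum zero is an isotropic
subspace which contains `W` and depends only on `S` and `X`.

Therefore finitely many isotropic subspaces contain all those of dimension at least two, and the
resonance variety is their union, up to the zero vector. As subspaces are closed and irreducible,
and have their linear dimension as Krull dimension (`zariskiDim_submodule`), the components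
of dimension `k ≥ 2` are the maximal isotropic subspaces of dimension `k`
(`isZariskiComponent_iff`). Finally, a pencil with at least three fibers can be read off from its
subspace, up to the scaling of the weight (`CombinatorialPencil.eq_of_space_eq`).
-/

/-! ### Zariski topology: linear subspaces are closed, irreducible, of the expected dimension -/

section Zariski

variable {K V : Type*} [Field K] [AddCommGroup V] [Module K V]

theorem dual_mem_zariskiPolynomials (φ : Module.Dual K V) :
    (fun v => φ v) ∈ zariskiPolynomials K V :=
  Algebra.subset_adjoin ⟨φ, rfl⟩

theorem isClosed_zeroLocus {f : V → K} (hf : f ∈ zariskiPolynomials K V) :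
    @IsClosed V (zariskiTopology K V) {v | f v = 0} := by
  let _ : TopologicalSpace V := zariskiTopology K V
  rw [← isOpen_compl_iff]
  exact TopologicalSpace.isOpen_generateFrom_of_mem ⟨f, hf, rfl⟩

theorem exists_ne_zero_of_mem_zariski_isOpen {U : Set V}
    (hU : @IsOpen V (zariskiTopology K V) U) {x : V} (hx : x ∈ U) :
    ∃ f ∈ zariskiPolynomials K V, f x ≠ 0 ∧ ∀ v, f v ≠ 0 → v ∈ U := by
  induction hU with
  | basic U h =>
    obtain ⟨f, hf, rfl⟩ := h
    exact ⟨f, hf, hx, fun v hv => hv⟩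
  | univ => exact ⟨1, one_mem _, one_ne_zero, fun v _ => trivial⟩
  | inter U U' _ _ ih ih' =>
    obtain ⟨f, hf, hfx, hfU⟩ := ih hx.1
    obtain ⟨g, hg, hgx, hgU⟩ := ih' hx.2
    refine ⟨f * g, mul_mem hf hg, mul_ne_zero hfx hgx, fun v hv => ?_⟩
    exact ⟨hfU v (left_ne_zero_of_mul hv), hgU v (right_ne_zero_of_mul hv)⟩
  | sUnion S _ ih =>
    obtain ⟨U, hU, hxU⟩ := hx
    obtain ⟨f, hf, hfx, hfU⟩ := ih U hU hxU
    exact ⟨f, hf, hfx, fun v hv => ⟨U, hU, hfU v hv⟩⟩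

theorem exists_zero_of_notMem_zariski_isClosed {A : Set V}
    (hA : @IsClosed V (zariskiTopology K V) A) {x : V} (hx : x ∉ A) :
    ∃ f ∈ zariskiPolynomials K V, f x ≠ 0 ∧ ∀ v ∈ A, f v = 0 := by
  obtain ⟨f, hf, hfx, h⟩ := exists_ne_zero_of_mem_zariski_isOpen hA.isOpen_compl hx
  exact ⟨f, hf, hfx, fun v hv => by_contra fun hfv => h v hfv hv⟩

/-- A polynomial function restricts to a polynomial in one variable on every line. -/
theorem exists_polynomial_eval_line {f : V → K} (hf : f ∈ zariskiPolynomials K V) (x y : V) :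
    ∃ P : Polynomial K, ∀ t : K, f (x + t • y) = P.eval t := by
  induction hf using Algebra.adjoin_induction with
  | mem f h =>
    obtain ⟨φ, rfl⟩ := h
    exact ⟨.C (φ x) + .C (φ y) * .X, fun t => by simp; ring⟩
  | algebraMap r => exact ⟨.C r, fun t => by simp⟩
  | add f g _ _ hf hg =>
    obtain ⟨P, hP⟩ := hf
    obtain ⟨Q, hQ⟩ := hg
    exact ⟨P + Q, fun t => by simp [hP, hQ]⟩
  | mul f g _ _ hf hg =>
    obtain ⟨P, hP⟩ := hf
    obtain ⟨Q, hQ⟩ := hg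
    exact ⟨P * Q, fun t => by simp [hP, hQ]⟩

/-- A subspace over an infinite field is irreducible, because it contains the line through any two
of its points. -/
theorem isIrreducible_submodule [Infinite K] (W : Submodule K V) :
    @IsIrreducible V (zariskiTopology K V) (W : Set V) := by
  let _ : TopologicalSpace V := zariskiTopology K V
  refine ⟨⟨0, W.zero_mem⟩, ?_⟩
  rintro U U' hU hU' ⟨x, hxW, hxU⟩ ⟨y, hyW, hyU⟩
  obtain ⟨f, hf, hfx, hfU⟩ := exists_ne_zero_of_mem_zariski_isOpen hU hxU
  obtain ⟨g, hg, hgy, hgU⟩ := exists_ne_zero_of_mem_zariski_isOpen hU' hyU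
  -- On the line through `x` and `y`, both functions are nonzero polynomials in one variable.
  obtain ⟨P, hP⟩ := exists_polynomial_eval_line hf x (y - x)
  obtain ⟨Q, hQ⟩ := exists_polynomial_eval_line hg x (y - x)
  have hP0 : P ≠ 0 := by
    rintro rfl
    exact hfx (by simpa using hP 0)
  have hQ0 : Q ≠ 0 := by
    rintro rfl
    exact hgy (by simpa using hQ 1)
  obtain ⟨t, ht⟩ : ∃ t, (P * Q).eval t ≠ 0 := by
    by_contra! h
    exact mul_ne_zero hP0 hQ0 (Polynomial.funext (by simpa using h))
  rw [Polynomial.eval_mul] at ht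
  refine ⟨x + t • (y - x), W.add_mem hxW (W.smul_mem t (W.sub_mem hyW hxW)), hfU _ ?_, hgU _ ?_⟩
  · rw [hP]
    exact left_ne_zero_of_mul ht
  · rw [hQ]
    exact right_ne_zero_of_mul ht

theorem isClosed_submodule (W : Submodule K V) :
    @IsClosed V (zariskiTopology K V) (W : Set V) := by
  let _ : TopologicalSpace V := zariskiTopology K V
  have h : (W : Set V) = ⋂ φ : {φ : Module.Dual K V // W ≤ LinearMap.ker φ}, {v | φ.1 v = 0} := by
    ext v
    simp only [SetLike.mem_coe, Set.mem_iInter, Set.mem_ofPred_eq]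
    refine ⟨fun hv φ => φ.2 hv, fun h => by_contra fun hv => ?_⟩
    obtain ⟨φ, hφ, hW⟩ := Submodule.exists_le_ker_of_notMem hv
    exact hφ (h ⟨φ, hW⟩)
  rw [h]
  exact isClosed_iInter fun φ => isClosed_zeroLocus (dual_mem_zariskiPolynomials φ.1)

/-- The Zariski topology of a subspace is induced by the one of the ambient space, because every
linear functional extends. -/
theorem zariskiTopology_submodule (W : Submodule K V) :
    zariskiTopology K W = (zariskiTopology K V).induced W.subtype := by
  rw [zariskiTopology, zariskiTopology, induced_generateFrom_eq]
  congr 1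
  ext U
  simp only [Set.mem_image, Set.mem_ofPred_eq]
  constructor
  · rintro ⟨f, hf, rfl⟩
    suffices h : ∃ g ∈ zariskiPolynomials K V, ∀ w : W, g w = f w by
      obtain ⟨g, hg, hgf⟩ := h
      exact ⟨_, ⟨g, hg, rfl⟩, by ext w; simp [hgf]⟩
    induction hf using Algebra.adjoin_induction with
    | mem f h =>
      obtain ⟨φ, rfl⟩ := h
      obtain ⟨ψ, hψ⟩ := LinearMap.exists_extend φ
      exact ⟨_, dual_mem_zariskiPolynomials ψ, fun w => by rw [← hψ]; rfl⟩
    | algebraMap r => exact ⟨_, (zariskiPolynomials K V).algebraMap_mem r, fun w => rfl⟩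
    | add f g _ _ hf hg =>
      obtain ⟨P, hP, h⟩ := hf
      obtain ⟨Q, hQ, h'⟩ := hg
      exact ⟨P + Q, add_mem hP hQ, fun t => by simp [h, h']⟩
    | mul f g _ _ hf hg =>
      obtain ⟨P, hP, h⟩ := hf
      obtain ⟨Q, hQ, h'⟩ := hg
      exact ⟨P * Q, mul_mem hP hQ, fun t => by simp [h, h']⟩
  · rintro ⟨_, ⟨f, hf, rfl⟩, rfl⟩
    refine ⟨fun w => f w, ?_, rfl⟩
    induction hf using Algebra.adjoin_induction with
    | mem f h =>
      obtain ⟨φ, rfl⟩ := h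
      exact dual_mem_zariskiPolynomials (φ ∘ₗ W.subtype)
    | algebraMap r => exact (zariskiPolynomials K W).algebraMap_mem r
    | add f g _ _ hf hg => exact add_mem hf hg
    | mul f g _ _ hf hg => exact mul_mem hf hg

/-- The polynomial functions on a space of dimension `n` are a quotient of the polynomial ring in
`n` variables. -/
theorem ringKrullDim_zariskiPolynomials_le [FiniteDimensional K V] :
    ringKrullDim (zariskiPolynomials K V) ≤ Module.finrank K V := by
  let b := Module.finBasis K V
  let ev : MvPolynomial (Fin (Module.finrank K V)) K →ₐ[K] zariskiPolynomials K V :=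
    MvPolynomial.aeval fun i => ⟨_, dual_mem_zariskiPolynomials (b.coord i)⟩
  have hev : Function.Surjective ev := by
    have hrange : zariskiPolynomials K V ≤ ((zariskiPolynomials K V).val.comp ev).range := by
      refine Algebra.adjoin_le ?_
      rintro _ ⟨φ, rfl⟩
      refine ⟨∑ i, MvPolynomial.C (φ (b i)) * MvPolynomial.X i, ?_⟩
      ext v
      have hv : φ v = ∑ i, φ (b i) * b.repr v i := by
        conv_lhs => rw [← b.sum_repr v, map_sum]
        exact Finset.sum_congr rfl fun i _ => by rw [map_smul, smul_eq_mul, mul_comm]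
      simpa [ev, Finset.sum_apply] using hv.symm
    intro f
    obtain ⟨P, hP⟩ := hrange f.2
    exact ⟨P, Subtype.ext hP⟩
  refine (ringKrullDim_le_of_surjective ev.toRingHom hev).trans ?_
  rw [MvPolynomial.ringKrullDim_of_isNoetherianRing, ringKrullDim_eq_zero_of_field]
  simp

/-- The ideal of the polynomial functions that vanish on an irreducible set. -/
def vanishingPrime (A : Set V) (hA : @IsIrreducible V (zariskiTopology K V) A) :
    PrimeSpectrum (zariskiPolynomials K V) where
  asIdeal :=
    { carrier := {f | ∀ v ∈ A, f.1 v = 0}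
      add_mem' := fun {f g} hf hg v hv => by
        simp [hf v hv, hg v hv]
      zero_mem' := fun v _ => rfl
      smul_mem' := fun g f hf v hv => by
        simp [hf v hv] }
  isPrime := by
    let _ : TopologicalSpace V := zariskiTopology K V
    refine ⟨fun h => ?_, fun {f g} hfg => ?_⟩
    · obtain ⟨v, hv⟩ := hA.1
      exact one_ne_zero ((Ideal.eq_top_iff_one _).1 h v hv)
    · have h := (isPreirreducible_iff_isClosed_union_isClosed.1 hA.2) _ _
        (isClosed_zeroLocus f.2) (isClosed_zeroLocus g.2)
        (fun v hv => by simpa using mul_eq_zero.1 (hfg v hv))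
      exact h

/-- Chains of irreducible closed sets give chains of prime ideals of the ring of polynomial
functions, and chains of subspaces are chains of irreducible closed sets. -/
theorem topologicalKrullDim_zariski [Infinite K] [FiniteDimensional K V] :
    @topologicalKrullDim V (zariskiTopology K V) = Module.finrank K V := by
  let _ : TopologicalSpace V := zariskiTopology K V
  apply le_antisymm
  · refine le_trans ?_ ringKrullDim_zariskiPolynomials_le
    rw [topologicalKrullDim, ringKrullDim, ← Order.krullDim_orderDual (α := PrimeSpectrum _)]
    refine Order.krullDim_le_of_strictMono
      (fun A => OrderDual.toDual (vanishingPrime A.1 A.2)) ?_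
    refine fun A A' h => lt_iff_le_not_ge.2 ⟨fun f hf v hv => hf v (h.le hv), fun h' => h.not_ge ?_⟩
    intro x hx
    by_contra hxA
    obtain ⟨f, hf, hfx, hfA⟩ := exists_zero_of_notMem_zariski_isClosed A.3 hxA
    exact hfx (h' (x := ⟨f, hf⟩) hfA x hx)
  · have h : (Module.finrank K V : WithBot ℕ∞) = Order.krullDim (Submodule K V) := by
      rw [← Module.coe_length, Module.length_eq_finrank]
      rfl
    rw [h]
    refine Order.krullDim_le_of_strictMono
      (fun W => ⟨W, isIrreducible_submodule W, isClosed_submodule W⟩) ?_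
    intro W W' h
    exact h

theorem zariskiDim_submodule [Infinite K] [FiniteDimensional K V] (W : Submodule K V) :
    zariskiDim K (W : Set V) = Module.finrank K W := by
  rw [← topologicalKrullDim_zariski (K := K) (V := W), zariskiTopology_submodule]
  rfl

end Zariski

/-! ### Coordinates in degree one and products in degree two of the Orlik-Solomon algebra -/

namespace LineCombinatorics

variable {α : Type*} [DecidableEq α] (C : LineCombinatorics α)

/-- Two distinct lines are together in exactly one point, so a sum over pairs of distinct lines may
be taken point by point. -/
theorem sum_points_sum_sum {A : Type*} [AddCommGroup A] (g : α → α → A) (hg : ∀ l, g l l = 0) :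
    ∑ p ∈ C.points, ∑ l ∈ p, ∑ m ∈ p, g l m = ∑ l ∈ C.lines, ∑ m ∈ C.lines, g l m := by
  have h1 : ∀ p ∈ C.points, ∑ l ∈ p, ∑ m ∈ p, g l m =
      ∑ l ∈ C.lines, ∑ m ∈ C.lines, if l ∈ p ∧ m ∈ p then g l m else 0 := by
    intro p hp
    have hpC := C.point_subset p hp
    refine Finset.sum_subset_zero_on_sdiff hpC
      (fun l hl => Finset.sum_eq_zero fun m _ => if_neg fun h => ?_) fun l hl =>
      Finset.sum_subset_zero_on_sdiff hpC (fun m hm => if_neg fun h => ?_) fun m hm =>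
        (if_pos ⟨hl, hm⟩).symm
    · exact (Finset.mem_sdiff.1 hl).2 h.1
    · exact (Finset.mem_sdiff.1 hm).2 h.2
  rw [Finset.sum_congr rfl h1, Finset.sum_comm]
  refine Finset.sum_congr rfl fun l hl => ?_
  rw [Finset.sum_comm]
  refine Finset.sum_congr rfl fun m hm => ?_
  by_cases hlm : l = m
  · subst hlm
    simp [hg]
  · obtain ⟨p, ⟨hp, hlp, hmp⟩, hu⟩ := C.existsUnique_point l hl m hm hlm
    rw [Finset.sum_eq_single_of_mem p hp, if_pos ⟨hlp, hmp⟩]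
    intro q hq hqp
    exact if_neg fun h => hqp (hu q ⟨hq, h⟩)

/-- The coordinates of an element of the degree one part: its unique representative with sum
zero, extended by zero to a function on `α`. -/
noncomputable def coord : C.E₁ →ₗ[ℚ] (α → ℚ) :=
  Submodule.liftQ _
    ({  toFun := fun a l => if h : l ∈ C.lines then a ⟨l, h⟩ - (∑ m, a m) / C.lines.card else 0
        map_add' := fun a b => by
          ext l
          by_cases h : l ∈ C.lines
          · simp [h, Finset.sum_add_distrib]
            ring
          · simp [h]
        map_smul' := fun c a => by
          ext l
          by_cases h : l ∈ C.lines
          · simp [h, ← Finset.mul_sum]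
            ring
          · simp [h] } : (C.lines → ℚ) →ₗ[ℚ] (α → ℚ))
    (by
      rw [Submodule.span_singleton_le_iff_mem, LinearMap.mem_ker]
      ext l
      by_cases h : l ∈ C.lines
      · have h0 : (C.lines.card : ℚ) ≠ 0 := Nat.cast_ne_zero.2 (Finset.card_ne_zero_of_mem h)
        simp [h, h0]
      · simp [h])

/-- The element `∑_l a_l x_l` of the degree one part attached to a function `a`. -/
def ofFun : (α → ℚ) →ₗ[ℚ] C.E₁ :=
  Submodule.mkQ _ ∘ₗ LinearMap.funLeft ℚ ℚ (Subtype.val : C.lines → α)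

/-- The functions supported on the lines and with sum zero. -/
def sumZero : Submodule ℚ (α → ℚ) where
  carrier := {a | (∀ l ∉ C.lines, a l = 0) ∧ ∑ l ∈ C.lines, a l = 0}
  add_mem' := fun {a b} ha hb =>
    ⟨fun l hl => by simp [ha.1 l hl, hb.1 l hl], by simp [Finset.sum_add_distrib, ha.2, hb.2]⟩
  zero_mem' := by simp
  smul_mem' := fun c a ha => ⟨fun l hl => by simp [ha.1 l hl], by simp [← Finset.mul_sum, ha.2]⟩

theorem coord_ofFun_apply (a : α → ℚ) {l : α} (hl : l ∈ C.lines) :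
    C.coord (C.ofFun a) l = a l - (∑ m ∈ C.lines, a m) / C.lines.card := by
  rw [← Finset.sum_coe_sort C.lines]
  change (if h : l ∈ C.lines then _ else _) = _
  rw [dif_pos hl]
  rfl

theorem coord_apply_of_notMem (ω : C.E₁) {l : α} (hl : l ∉ C.lines) : C.coord ω l = 0 := by
  obtain ⟨a, rfl⟩ := Submodule.Quotient.mk_surjective _ ω
  exact dif_neg hl

theorem exists_ofFun (ω : C.E₁) : ∃ a : α → ℚ, C.ofFun a = ω := by
  obtain ⟨a, rfl⟩ := Submodule.Quotient.mk_surjective _ ω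
  refine ⟨fun l => if h : l ∈ C.lines then a ⟨l, h⟩ else 0, congrArg Submodule.Quotient.mk ?_⟩
  ext l
  simp [LinearMap.funLeft_apply]

theorem coord_mem_sumZero (ω : C.E₁) : C.coord ω ∈ C.sumZero := by
  refine ⟨fun l hl => C.coord_apply_of_notMem ω hl, ?_⟩
  obtain ⟨a, rfl⟩ := C.exists_ofFun ω
  rw [Finset.sum_congr rfl fun l hl => C.coord_ofFun_apply a hl, Finset.sum_sub_distrib]
  by_cases h : C.lines.card = 0
  · simp [Finset.card_eq_zero.1 h]
  · have h0 : (C.lines.card : ℚ) ≠ 0 := Nat.cast_ne_zero.2 h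
    simp only [Finset.sum_const, nsmul_eq_mul]
    field_simp
    ring

theorem coord_ofFun {a : α → ℚ} (ha : a ∈ C.sumZero) : C.coord (C.ofFun a) = a := by
  ext l
  by_cases hl : l ∈ C.lines
  · rw [C.coord_ofFun_apply a hl, ha.2]
    simp
  · rw [C.coord_apply_of_notMem _ hl, ha.1 l hl]

theorem ofFun_coord (ω : C.E₁) : C.ofFun (C.coord ω) = ω := by
  obtain ⟨a, rfl⟩ := C.exists_ofFun ω
  rw [← sub_eq_zero, ← map_sub]
  refine (Submodule.Quotient.mk_eq_zero _).2 (Submodule.mem_span_singleton.2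
    ⟨-((∑ m ∈ C.lines, a m) / C.lines.card), ?_⟩)
  ext l
  simp [LinearMap.funLeft_apply, C.coord_ofFun_apply a l.2]

theorem coord_injective : Function.Injective C.coord :=
  Function.LeftInverse.injective C.ofFun_coord

theorem ofFun_eq_sum (a : α → ℚ) : C.ofFun a = ∑ l : C.lines, a l • C.x l := by
  have h : (fun l : C.lines => a l) = ∑ l : C.lines, a l • Pi.single l (1 : ℚ) := by
    ext m
    simp [Finset.sum_apply, Pi.single_apply]
  change Submodule.mkQ _ (fun l : C.lines => a l) = _
  rw [h, map_sum]
  rfl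

theorem coord_x_sub_x (i j : C.lines) (l : α) :
    C.coord (C.x j - C.x i) l = (if (j : α) = l then 1 else 0) - if (i : α) = l then 1 else 0 := by
  have h : ∀ i : C.lines, C.x i = C.ofFun (Pi.single (i : α) 1) := by
    intro i
    refine congrArg Submodule.Quotient.mk ?_
    ext m
    simp [LinearMap.funLeft_apply, Pi.single_apply]
  by_cases hl : l ∈ C.lines
  · have h1 : ∀ i : C.lines, C.coord (C.x i) l =
        (if (i : α) = l then 1 else 0) - 1 / C.lines.card := by
      intro i
      rw [h, C.coord_ofFun_apply _ hl, Finset.sum_pi_single', if_pos i.2, Pi.single_apply]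
      simp only [@eq_comm α l]
    rw [map_sub, Pi.sub_apply, h1, h1]
    ring
  · rw [C.coord_apply_of_notMem _ hl, if_neg, if_neg, sub_zero]
    · rintro rfl
      exact hl i.2
    · rintro rfl
      exact hl j.2

end LineCombinatorics

section ExteriorPlane

theorem ι_mul_ι_mul_ι_plane (u v w : Fin 2 → ℚ) :
    ExteriorAlgebra.ι ℚ u * ExteriorAlgebra.ι ℚ v * ExteriorAlgebra.ι ℚ w = 0 := by
  have h := (ExteriorAlgebra.ιMulti ℚ (M := Fin 2 → ℚ) 3).map_linearDependent ![u, v, w]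
    (fun h => by simpa using h.fintype_card_le_finrank)
  simpa [ExteriorAlgebra.ιMulti_apply, mul_assoc] using h

theorem ι_mul_ι_plane_eq_zero_iff (u v : Fin 2 → ℚ) :
    ExteriorAlgebra.ι ℚ u * ExteriorAlgebra.ι ℚ v = 0 ↔ u 0 * v 1 = v 0 * u 1 := by
  constructor
  · intro h
    let f : ∀ i, (Fin 2 → ℚ) [⋀^Fin i]→ₗ[ℚ] ℚ
      | 2 => Matrix.detRowAlternating
      | _ => 0
    have hD := ExteriorAlgebra.liftAlternating_apply_ιMulti (R := ℚ) f ![u, v]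
    have h0 : ExteriorAlgebra.ιMulti ℚ 2 ![u, v] = 0 := by
      simpa [ExteriorAlgebra.ιMulti_apply] using h
    rw [h0, map_zero] at hD
    have hdet : (Matrix.of ![u, v]).det = 0 := hD.symm
    rw [Matrix.det_fin_two] at hdet
    simp at hdet
    linarith
  · intro h
    have hdep : ¬ LinearIndependent ℚ ![u, v] := by
      intro hli
      have h2 : LinearIndependent ℚ (Matrix.of ![u, v]).row := hli
      rw [Matrix.linearIndependent_rows_iff_isUnit, Matrix.isUnit_iff_isUnit_det,
        Matrix.det_fin_two] at h2
      simp [h] at h2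
      apply h2
      linarith
    have h := (ExteriorAlgebra.ιMulti ℚ (M := Fin 2 → ℚ) 2).map_linearDependent ![u, v] hdep
    simpa [ExteriorAlgebra.ιMulti_apply] using h

end ExteriorPlane

namespace LineCombinatorics

variable {α : Type*} [DecidableEq α] (C : LineCombinatorics α)

/-- The identity `x_j x_k - x_i x_k + x_i x_j = (x_j - x_i)(x_k - x_i)` in the exterior algebra. -/
theorem wordBoundary_three (i j k : C.lines) :
    C.wordBoundary [i, j, k] =
      ExteriorAlgebra.ι ℚ (C.x j - C.x i) * ExteriorAlgebra.ι ℚ (C.x k - C.x i) := by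
  have h := ExteriorAlgebra.ι_add_mul_swap (R := ℚ) (C.x j) (C.x i)
  have h' := ExteriorAlgebra.ι_sq_zero (R := ℚ) (C.x i)
  simp [wordBoundary, Fin.sum_univ_succ, wordProd, sub_mul, mul_sub, h']
  rw [← sub_eq_zero]
  rw [← eq_sub_iff_add_eq, zero_sub] at h
  rw [h]
  abel

theorem osι_mul_self (ω : C.E₁) : C.osι ω * C.osι ω = 0 := by
  change (TwoSidedIdeal.span C.osRelations).ringCon.mk' (ExteriorAlgebra.ι ℚ ω) *
    (TwoSidedIdeal.span C.osRelations).ringCon.mk' (ExteriorAlgebra.ι ℚ ω) = 0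
  rw [← map_mul, ExteriorAlgebra.ι_sq_zero, map_zero]

theorem osι_mul_swap (ω η : C.E₁) : C.osι ω * C.osι η = - (C.osι η * C.osι ω) := by
  have h := C.osι_mul_self (ω + η)
  simp only [map_add, add_mul, mul_add, osι_mul_self, zero_add, add_zero] at h
  exact eq_neg_of_add_eq_zero_right h

theorem osι_mul_osι_eq_zero_iff_mem (ω η : C.E₁) :
    C.osι ω * C.osι η = 0 ↔
      ExteriorAlgebra.ι ℚ ω * ExteriorAlgebra.ι ℚ η ∈ TwoSidedIdeal.span C.osRelations := by
  have h : ∀ z, z ∈ TwoSidedIdeal.span C.osRelations ↔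
      (TwoSidedIdeal.span C.osRelations).ringCon.mk' z = 0 := fun z => by
    rw [← TwoSidedIdeal.mem_ker, TwoSidedIdeal.ker_ringCon_mk']
  rw [h, map_mul]
  rfl

theorem osι_x_sub_mul_osι_x_sub {p : Finset α} (hp : p ∈ C.points) {i j k : C.lines}
    (hi : (i : α) ∈ p) (hj : (j : α) ∈ p) (hk : (k : α) ∈ p) :
    C.osι (C.x j - C.x i) * C.osι (C.x k - C.x i) = 0 := by
  by_cases hij : i = j
  · simp [hij]
  by_cases hik : i = k
  · simp [hik]
  by_cases hjk : j = k
  · rw [hjk, osι_mul_self]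
  rw [osι_mul_osι_eq_zero_iff_mem, ← wordBoundary_three]
  exact TwoSidedIdeal.subset_span
    (Or.inl (Or.inr ⟨i, j, k, hij, hik, hjk, ⟨p, hp, hi, hj, hk⟩, rfl⟩))

/-- The homomorphism of exterior algebras induced by a linear map to the plane kills the
Orlik-Solomon relations as soon as its second exterior power kills the relations in degree two:
the target vanishes in degrees greater than two. -/
theorem exteriorAlgebra_map_eq_zero_of_mem (f : C.E₁ →ₗ[ℚ] (Fin 2 → ℚ))
    (hf : ∀ p ∈ C.points, ∀ i j k : C.lines, (i : α) ∈ p → (j : α) ∈ p → (k : α) ∈ p →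
      f (C.x j - C.x i) 0 * f (C.x k - C.x i) 1 = f (C.x k - C.x i) 0 * f (C.x j - C.x i) 1)
    {z : ExteriorAlgebra ℚ C.E₁} (hz : z ∈ TwoSidedIdeal.span C.osRelations) :
    ExteriorAlgebra.map f z = 0 := by
  have hword : ∀ s : List C.lines, 3 ≤ s.length → ExteriorAlgebra.map f (C.wordProd s) = 0
    | i :: j :: k :: s, _ => by
      simp [wordProd, ← mul_assoc, ι_mul_ι_mul_ι_plane]
  have hle : TwoSidedIdeal.span C.osRelations ≤ TwoSidedIdeal.ker (ExteriorAlgebra.map f) := by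
    rw [TwoSidedIdeal.span_le]
    rintro z ((⟨s, hs, rfl⟩ | ⟨i, j, k, -, -, -, ⟨p, hp, hi, hj, hk⟩, rfl⟩) |
      ⟨i, j, k, -, -, -, -, rfl⟩)
    · refine (TwoSidedIdeal.mem_ker _).2 ?_
      rw [wordBoundary, map_sum]
      refine Finset.sum_eq_zero fun j _ => ?_
      rw [map_smul, hword, smul_zero]
      rw [List.length_eraseIdx_of_lt j.2]
      omega
    · refine (TwoSidedIdeal.mem_ker _).2 ?_
      rw [wordBoundary_three, map_mul, ExteriorAlgebra.map_apply_ι, ExteriorAlgebra.map_apply_ι,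
        ι_mul_ι_plane_eq_zero_iff]
      exact hf p hp i j k hi hj hk
    · exact (TwoSidedIdeal.mem_ker _).2 (hword _ le_rfl)
  exact (TwoSidedIdeal.mem_ker _).1 (hle hz)

/-- The linear map to the plane given by the coordinate at `l` and the sum of the coordinates over
the point `p`. -/
noncomputable def pointPlane (l : α) (p : Finset α) : C.E₁ →ₗ[ℚ] (Fin 2 → ℚ) :=
  LinearMap.pi ![LinearMap.proj l ∘ₗ C.coord, (∑ m ∈ p, LinearMap.proj m) ∘ₗ C.coord]

theorem pointPlane_zero (l : α) (p : Finset α) (ω : C.E₁) :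
    C.pointPlane l p ω 0 = C.coord ω l := rfl

theorem pointPlane_one (l : α) (p : Finset α) (ω : C.E₁) :
    C.pointPlane l p ω 1 = ∑ m ∈ p, C.coord ω m := by
  simp [pointPlane]

/-- The determinant of the two vectors vanishes: for `q = p` the second entries are zero, and
otherwise at most one of the three lines passes through `p`. -/
theorem pointPlane_relation {l : α} {p : Finset α} (hp : p ∈ C.points) (hl : l ∈ p)
    {q : Finset α} (hq : q ∈ C.points) {i j k : C.lines} (hi : (i : α) ∈ q) (hj : (j : α) ∈ q)
    (hk : (k : α) ∈ q) :
    C.pointPlane l p (C.x j - C.x i) 0 * C.pointPlane l p (C.x k - C.x i) 1 =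
      C.pointPlane l p (C.x k - C.x i) 0 * C.pointPlane l p (C.x j - C.x i) 1 := by
  simp only [pointPlane_zero, pointPlane_one, coord_x_sub_x, Finset.sum_sub_distrib,
    Finset.sum_ite_eq]
  by_cases hpq : p = q
  · subst hpq
    simp [hi, hj, hk]
  · have hmeet : ∀ a b : C.lines, (a : α) ∈ q → (b : α) ∈ q → (a : α) ∈ p → (b : α) ∈ p →
        (a : α) = b := by
      intro a b haq hbq hap hbp
      by_contra hab
      exact hpq ((C.existsUnique_point a a.2 b b.2 hab).unique ⟨hp, hap, hbp⟩ ⟨hq, haq, hbq⟩)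
    have key : ∀ a : C.lines, (a : α) ∉ p → (if (a : α) = l then (1 : ℚ) else 0) = 0 :=
      by
        intro a ha
        refine if_neg ?_
        rintro rfl
        exact ha hl
    by_cases h1 : (i : α) ∈ p <;> by_cases h2 : (j : α) ∈ p <;> by_cases h3 : (k : α) ∈ p
    · rw [hmeet i j hi hj h1 h2, hmeet j k hj hk h2 h3]
    · rw [hmeet i j hi hj h1 h2]
      ring
    · rw [hmeet i k hi hk h1 h3]
      ring
    · rw [key j h2, key k h3, if_neg h2, if_neg h3]
    · rw [hmeet j k hj hk h2 h3]
    · rw [key i h1, key k h3, if_neg h1, if_neg h3]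
      ring
    · rw [key i h1, key j h2, if_neg h1, if_neg h2]
      ring
    · rw [key i h1, key j h2, key k h3, if_neg h1, if_neg h2, if_neg h3]

/-- The product is the sum over the points of the products of the restrictions. -/
theorem osι_mul_osι_eq_sum (ω η : C.E₁) :
    C.osι ω * C.osι η = ∑ p ∈ C.points,
      C.osι (C.ofFun (p.piecewise (C.coord ω) 0)) *
        C.osι (C.ofFun (p.piecewise (C.coord η) 0)) := by
  have hsum : ∀ s : Finset α, s ⊆ C.lines → ∀ a : α → ℚ,
      C.osι (C.ofFun (s.piecewise a 0)) = ∑ l ∈ s, C.osι (C.ofFun (Pi.single l (a l))) := by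
    intro s hs a
    rw [← map_sum, ← map_sum]
    congr 2
    ext l
    simp [Finset.sum_apply, Pi.single_apply, Finset.piecewise]
  have hω : ∀ ω : C.E₁, C.osι ω = ∑ l ∈ C.lines, C.osι (C.ofFun (Pi.single l (C.coord ω l))) := by
    intro ω
    rw [← hsum _ subset_rfl]
    conv_lhs => rw [← C.ofFun_coord ω]
    congr 2
    ext l
    by_cases hl : l ∈ C.lines
    · simp [hl]
    · simp [hl, C.coord_apply_of_notMem]
  rw [hω ω, hω η, Finset.sum_mul_sum, ← C.sum_points_sum_sum]
  · refine Finset.sum_congr rfl fun p hp => ?_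
    rw [hsum p (C.point_subset p hp), hsum p (C.point_subset p hp), Finset.sum_mul_sum]
  · intro l
    have h : ∀ c : ℚ, (Pi.single l c : α → ℚ) = c • Pi.single l 1 := fun c => by
      rw [← Pi.single_smul, smul_eq_mul, mul_one]
    rw [h (C.coord ω l), h (C.coord η l)]
    simp only [map_smul, smul_mul_assoc, mul_smul_comm, osι_mul_self, smul_zero]

/-- At a point, the relations make the product of two vectors `∑_l a_l x_l` and `∑_l b_l x_l`
equal to the product of `x_i` with `∑_l (a(p) b_l - b(p) a_l) (x_l - x_i)`, for every line `i`
through the point. -/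
theorem osι_ofFun_mul_eq_zero {p : Finset α} (hp : p ∈ C.points) {a b : α → ℚ}
    (h : ∀ l ∈ p, a l * ∑ m ∈ p, b m = b l * ∑ m ∈ p, a m) :
    C.osι (C.ofFun (p.piecewise a 0)) * C.osι (C.ofFun (p.piecewise b 0)) = 0 := by
  have hpC := C.point_subset p hp
  obtain ⟨i, hi⟩ : p.Nonempty := Finset.card_pos.1 (by have := C.one_lt_card p hp; omega)
  let y : α → C.E₁ := fun l => C.ofFun (Pi.single l 1)
  have hyx : ∀ l (hl : l ∈ p), y l = C.x ⟨l, hpC hl⟩ := by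
    intro l hl
    refine congrArg Submodule.Quotient.mk ?_
    ext m
    simp [LinearMap.funLeft_apply, Pi.single_apply, Subtype.ext_iff]
  have hrel : ∀ l ∈ p, ∀ m ∈ p, C.osι (y l - y i) * C.osι (y m - y i) = 0 := by
    intro l hl m hm
    rw [hyx l hl, hyx m hm, hyx i hi]
    exact C.osι_x_sub_mul_osι_x_sub hp hi hl hm
  have hdec : ∀ a : α → ℚ, C.ofFun (p.piecewise a 0) =
      (∑ l ∈ p, a l) • y i + ∑ l ∈ p, a l • (y l - y i) := by
    intro a
    have : p.piecewise a 0 = ∑ l ∈ p, a l • (Pi.single l 1 : α → ℚ) := by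
      ext l
      simp [Finset.sum_apply, Pi.single_apply, Finset.piecewise]
    rw [this, map_sum]
    simp only [map_smul, smul_sub, Finset.sum_sub_distrib, ← Finset.sum_smul]
    simp [y]
  have hprod : C.osι (∑ l ∈ p, a l • (y l - y i)) * C.osι (∑ l ∈ p, b l • (y l - y i)) = 0 := by
    rw [map_sum, map_sum, Finset.sum_mul_sum]
    refine Finset.sum_eq_zero fun l hl => Finset.sum_eq_zero fun m hm => ?_
    rw [map_smul, map_smul, smul_mul_smul_comm, hrel l hl m hm, smul_zero]
  have hlin : (∑ l ∈ p, a l) • ∑ l ∈ p, b l • (y l - y i) =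
      (∑ l ∈ p, b l) • ∑ l ∈ p, a l • (y l - y i) := by
    rw [Finset.smul_sum, Finset.smul_sum]
    refine Finset.sum_congr rfl fun l hl => ?_
    rw [smul_smul, smul_smul, mul_comm, ← h l hl, mul_comm]
  rw [hdec a, hdec b]
  simp only [map_add, mul_add, add_mul, hprod, add_zero]
  rw [map_smul, map_smul, smul_mul_smul_comm, osι_mul_self, smul_zero, zero_add,
    smul_mul_assoc, mul_smul_comm, osι_mul_swap, smul_neg, neg_add_eq_zero, ← mul_smul_comm,
    ← mul_smul_comm, ← map_smul, ← map_smul, hlin]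

/-- Two vectors have product zero in the Orlik-Solomon algebra if and only if, at each point `p`,
their restrictions to `p` satisfy `a(p) b = b(p) a`, where `a(p)` is the sum over `p`. -/
theorem osι_mul_osι_eq_zero_iff (ω η : C.E₁) :
    C.osι ω * C.osι η = 0 ↔ ∀ p ∈ C.points, ∀ l ∈ p,
      C.coord ω l * ∑ m ∈ p, C.coord η m = C.coord η l * ∑ m ∈ p, C.coord ω m := by
  constructor
  · intro h p hp l hl
    have h0 := C.exteriorAlgebra_map_eq_zero_of_mem (C.pointPlane l p)
      (fun q hq i j k hi hj hk => C.pointPlane_relation hp hl hq hi hj hk)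
      ((C.osι_mul_osι_eq_zero_iff_mem ω η).1 h)
    rw [map_mul, ExteriorAlgebra.map_apply_ι, ExteriorAlgebra.map_apply_ι,
      ι_mul_ι_plane_eq_zero_iff] at h0
    simpa only [pointPlane_zero, pointPlane_one] using h0
  · intro h
    rw [osι_mul_osι_eq_sum]
    exact Finset.sum_eq_zero fun p hp => C.osι_ofFun_mul_eq_zero hp (h p hp)

end LineCombinatorics

/-! ### The quadratic form of a set of points -/

namespace LineCombinatorics

variable {α : Type*} {S : Finset α} {X : Finset (Finset α)}

/-- Two distinct lines are linked, relative to a set `X` of points, if they do not meet in a point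
of `X`. -/
def Linked (X : Finset (Finset α)) (l m : α) : Prop :=
  l ≠ m ∧ ∀ p ∈ X, ¬ (l ∈ p ∧ m ∈ p)

theorem Linked.symm {l m : α} (h : Linked X l m) : Linked X m l :=
  ⟨h.1.symm, fun p hp hlm => h.2 p hp hlm.symm⟩

/-- The equivalence relation generated by the linked pairs in a set `S` of lines. Its classes
in `S` are called blocks. -/
def blockSetoid (S : Finset α) (X : Finset (Finset α)) : Setoid α :=
  Relation.EqvGen.setoid fun l m => l ∈ S ∧ m ∈ S ∧ Linked X l m

theorem blockSetoid_mem_iff {l m : α} (h : blockSetoid S X l m) : l ∈ S ↔ m ∈ S := by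
  induction h with
  | rel x y h => exact iff_of_true h.1 h.2.1
  | refl x => rfl
  | symm x y _ ih => exact ih.symm
  | trans x y z _ _ ih ih' => exact ih.trans ih'

theorem blockSetoid_of_linked {l m : α} (hl : l ∈ S) (hm : m ∈ S) (h : Linked X l m) :
    blockSetoid S X l m :=
  Relation.EqvGen.rel _ _ ⟨hl, hm, h⟩

variable [DecidableEq α] (C : LineCombinatorics α)

open Classical in
/-- The `l`-th entry of the vector `(MᵀM - J) z`, where `M` is the incidence matrix of the points in
`X` with the lines, and `J` the matrix all of whose entries are one. For `X` contained in the points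
of `C`, the off-diagonal entries of `MᵀM - J` are `-1` for linked pairs and `0` for all others. -/
noncomputable def quadRow (X : Finset (Finset α)) (z : α → ℚ) (l : α) : ℚ :=
  ((X.filter (l ∈ ·)).card - 1) * z l - ∑ m ∈ C.lines, if Linked X l m then z m else 0

/-- The functions supported on `S`, with sum zero, and with sum zero over each point of `X`. -/
def pointKernel (S : Finset α) (X : Finset (Finset α)) : Submodule ℚ (α → ℚ) where
  carrier := {a | (∀ l ∉ S, a l = 0) ∧ ∑ l ∈ C.lines, a l = 0 ∧ ∀ p ∈ X, ∑ l ∈ p, a l = 0}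
  add_mem' := fun {a b} ha hb =>
    ⟨fun l hl => by simp [ha.1 l hl, hb.1 l hl], by simp [Finset.sum_add_distrib, ha.2.1, hb.2.1],
      fun p hp => by simp [Finset.sum_add_distrib, ha.2.2 p hp, hb.2.2 p hp]⟩
  zero_mem' := by simp
  smul_mem' := fun c a ha =>
    ⟨fun l hl => by simp [ha.1 l hl], by simp [← Finset.mul_sum, ha.2.1],
      fun p hp => by simp [← Finset.mul_sum, ha.2.2 p hp]⟩

theorem mem_pointKernel {a : α → ℚ} :
    a ∈ C.pointKernel S X ↔
      (∀ l ∉ S, a l = 0) ∧ ∑ l ∈ C.lines, a l = 0 ∧ ∀ p ∈ X, ∑ l ∈ p, a l = 0 := Iff.rfl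

variable {C}

open Classical in
theorem card_filter_points (hX : X ⊆ C.points) {l m : α} (hl : l ∈ C.lines) (hm : m ∈ C.lines)
    (hlm : l ≠ m) :
    (X.filter fun p => l ∈ p ∧ m ∈ p).card = if Linked X l m then 0 else 1 := by
  split_ifs with h
  · rw [Finset.card_eq_zero, Finset.filter_eq_empty_iff]
    exact fun p hp => h.2 p hp
  · simp only [Linked, not_and, not_forall, not_not] at h
    obtain ⟨p, hp, hlp, hmp⟩ := h hlm
    rw [Finset.card_eq_one]
    refine ⟨p, Finset.eq_singleton_iff_unique_mem.2 ⟨Finset.mem_filter.2 ⟨hp, hlp, hmp⟩, ?_⟩⟩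
    intro q hq
    obtain ⟨hq, hlq⟩ := Finset.mem_filter.1 hq
    exact (C.existsUnique_point l hl m hm hlm).unique ⟨hX hq, hlq⟩ ⟨hX hp, hlp, hmp⟩

/-- Both sides are the `l`-th entry of `MᵀMz`. -/
theorem sum_filter_sum_eq_quadRow (hX : X ⊆ C.points) (z : α → ℚ) {l : α} (hl : l ∈ C.lines) :
    ∑ p ∈ X.filter (l ∈ ·), ∑ m ∈ p, z m = C.quadRow X z l + ∑ m ∈ C.lines, z m := by
  classical
  have h1 : ∑ p ∈ X.filter (l ∈ ·), ∑ m ∈ p, z m =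
      ∑ m ∈ C.lines, ((X.filter fun p => l ∈ p ∧ m ∈ p).card : ℚ) * z m := by
    have h : ∀ p ∈ X.filter (l ∈ ·),
        ∑ m ∈ p, z m = ∑ m ∈ C.lines, if m ∈ p then z m else 0 := by
      intro p hp
      rw [Finset.sum_ite_mem, Finset.inter_eq_right.2
        (C.point_subset p (hX (Finset.mem_filter.1 hp).1))]
    rw [Finset.sum_congr rfl h, Finset.sum_comm]
    refine Finset.sum_congr rfl fun m _ => ?_
    rw [← Finset.sum_filter, Finset.filter_filter, Finset.sum_const, nsmul_eq_mul]
  have h2 : ∀ m ∈ C.lines, ((X.filter fun p => l ∈ p ∧ m ∈ p).card : ℚ) * z m =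
      (if l = m then ((X.filter (l ∈ ·)).card - 1) * z l else 0) -
        (if Linked X l m then z m else 0) + z m := by
    intro m hm
    by_cases hlm : l = m
    · subst hlm
      simp [Linked]
      ring
    · rw [card_filter_points hX hl hm hlm]
      by_cases h : Linked X l m <;> simp [h, hlm]
  rw [h1, Finset.sum_congr rfl h2, Finset.sum_add_distrib, Finset.sum_sub_distrib,
    Finset.sum_ite_eq, if_pos hl]
  rfl

theorem quadRow_eq_zero (hX : X ⊆ C.points) {b : α → ℚ} (hb : b ∈ C.pointKernel S X) {l : α}
    (hl : l ∈ C.lines) : C.quadRow X b l = 0 := by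
  have h := sum_filter_sum_eq_quadRow hX b hl
  rw [hb.2.1, add_zero, Finset.sum_eq_zero] at h
  · exact h.symm
  · exact fun p hp => hb.2.2 p (Finset.mem_filter.1 hp).1

/-- The identity `|Mz|² = zᵀ(MᵀM - J)z + (∑ z)²`. -/
theorem sum_sq_points (hX : X ⊆ C.points) (z : α → ℚ) :
    ∑ p ∈ X, (∑ m ∈ p, z m) ^ 2 =
      ∑ l ∈ C.lines, z l * (C.quadRow X z l + ∑ m ∈ C.lines, z m) := by
  have h : ∀ p ∈ X, (∑ m ∈ p, z m) ^ 2 =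
      ∑ l ∈ C.lines, if l ∈ p then z l * ∑ m ∈ p, z m else 0 := by
    intro p hp
    rw [Finset.sum_ite_mem, Finset.inter_eq_right.2 (C.point_subset p (hX hp)), sq,
      Finset.sum_mul]
  rw [Finset.sum_congr rfl h, Finset.sum_comm]
  refine Finset.sum_congr rfl fun l hl => ?_
  rw [← sum_filter_sum_eq_quadRow hX z hl, ← Finset.sum_filter, Finset.mul_sum]

theorem quadRow_mul_of_linked {τ v : α → ℚ}
    (hτ : ∀ l ∈ S, ∀ m ∈ S, Linked X l m → τ l = τ m) (hv : ∀ l ∉ S, v l = 0) {l : α}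
    (hl : l ∈ S) : C.quadRow X (fun l => τ l * v l) l = τ l * C.quadRow X v l := by
  classical
  rw [quadRow, quadRow, mul_sub, Finset.mul_sum]
  congr 1
  · ring
  · refine Finset.sum_congr rfl fun m _ => ?_
    split_ifs with h
    · by_cases hm : m ∈ S
      · rw [hτ l hl m hm h]
      · rw [hv m hm, mul_zero, mul_zero]
    · rw [mul_zero]

theorem quadRow_abs_nonpos {a : α → ℚ} {l : α} (h : C.quadRow X a l = 0) :
    C.quadRow X (fun l => |a l|) l ≤ 0 := by
  classical
  rw [quadRow, sub_eq_zero] at h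
  rw [quadRow, sub_nonpos]
  calc ((X.filter (l ∈ ·)).card - 1 : ℚ) * |a l|
      ≤ |((X.filter (l ∈ ·)).card - 1 : ℚ) * a l| := by
        rw [abs_mul]
        exact mul_le_mul_of_nonneg_right (le_abs_self _) (abs_nonneg _)
    _ ≤ ∑ m ∈ C.lines, |if Linked X l m then a m else 0| := by
        rw [h]
        exact Finset.abs_sum_le_sum_abs _ _
    _ = ∑ m ∈ C.lines, if Linked X l m then |a m| else 0 :=
        Finset.sum_congr rfl fun m _ => by split_ifs <;> simp

/-- Let `a` be in the kernel of the incidence matrix. Any function with sum zero which is a multiple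
of `|a|` on each block is in the kernel too: the quadratic form `MᵀM` takes a value `≤ 0` at it. -/
theorem mul_abs_mem_pointKernel (hX : X ⊆ C.points) {a τ : α → ℚ}
    (ha : a ∈ C.pointKernel S X) (hτ : ∀ l ∈ S, ∀ m ∈ S, Linked X l m → τ l = τ m)
    (hsum : ∑ l ∈ C.lines, τ l * |a l| = 0) : (fun l => τ l * |a l|) ∈ C.pointKernel S X := by
  have ha0 : ∀ l ∉ S, |a l| = 0 := fun l hl => by rw [ha.1 l hl, abs_zero]
  refine ⟨fun l hl => by simp [ha.1 l hl], hsum, fun p hp => ?_⟩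
  have hle : ∑ p ∈ X, (∑ m ∈ p, τ m * |a m|) ^ 2 ≤ 0 := by
    rw [sum_sq_points hX, hsum]
    refine Finset.sum_nonpos fun l hl => ?_
    by_cases hlS : l ∈ S
    · rw [quadRow_mul_of_linked hτ ha0 hlS, add_zero]
      have h := quadRow_abs_nonpos (quadRow_eq_zero hX ha hl)
      calc τ l * |a l| * (τ l * C.quadRow X (fun l => |a l|) l)
          = (τ l ^ 2 * |a l|) * C.quadRow X (fun l => |a l|) l := by ring
        _ ≤ 0 := mul_nonpos_of_nonneg_of_nonpos (by positivity) h
    · rw [ha0 l hlS]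
      simp
  have h0 := (Finset.sum_eq_zero_iff_of_nonneg fun p _ => sq_nonneg (∑ m ∈ p, τ m * |a m|)).1
    (le_antisymm hle (Finset.sum_nonneg fun p _ => sq_nonneg _)) p hp
  exact pow_eq_zero_iff two_ne_zero |>.1 h0

/-- On a block, the kernel of `MᵀM - J` is spanned by any positive vector in it: subtracting the
multiple of the positive vector for which the least entry becomes zero, the zero spreads from each
line to the lines linked to it. -/
theorem mul_eq_mul_of_quadRow_eq_zero (hS : S ⊆ C.lines) {v b : α → ℚ} (hv : ∀ l ∈ S, 0 < v l)
    (hv0 : ∀ l ∉ S, v l = 0) (hb0 : ∀ l ∉ S, b l = 0) (hvq : ∀ l ∈ S, C.quadRow X v l = 0)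
    (hbq : ∀ l ∈ S, C.quadRow X b l = 0) {l m : α} (hl : l ∈ S) (hlm : blockSetoid S X l m) :
    b l * v m = b m * v l := by
  classical
  obtain ⟨i, hi, hmin⟩ := (S.filter (blockSetoid S X l)).exists_min_image (fun m => b m / v m)
    ⟨l, Finset.mem_filter.2 ⟨hl, (blockSetoid S X).refl l⟩⟩
  obtain ⟨hiS, hli⟩ := Finset.mem_filter.1 hi
  set ρ := b i / v i with hρ
  let c : α → ℚ := fun m => b m - ρ * v m
  have hc_nonneg : ∀ m, blockSetoid S X l m → 0 ≤ c m := by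
    intro m hm
    have hmS := (blockSetoid_mem_iff hm).1 hl
    have := hmin m (Finset.mem_filter.2 ⟨hmS, hm⟩)
    rw [le_div_iff₀ (hv m hmS)] at this
    exact sub_nonneg.2 this
  have hcq : ∀ l ∈ S, C.quadRow X c l = 0 := by
    intro l hl
    have : C.quadRow X c l = C.quadRow X b l - ρ * C.quadRow X v l := by
      have h : ∀ m ∈ C.lines, (if Linked X l m then c m else 0) =
          (if Linked X l m then b m else 0) - ρ * if Linked X l m then v m else 0 :=
        fun m _ => by split_ifs <;> simp [c]
      rw [quadRow, quadRow, quadRow, Finset.sum_congr rfl h, Finset.sum_sub_distrib,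
        ← Finset.mul_sum]
      simp only [c]
      ring
    rw [this, hbq l hl, hvq l hl, mul_zero, sub_zero]
  have hspread : ∀ x y, x ∈ S → y ∈ S → Linked X x y → blockSetoid S X l x → c x = 0 →
      c y = 0 := by
    intro x y hx hy hxy hlx hcx
    have h := hcq x hx
    rw [quadRow, hcx, mul_zero, zero_sub, neg_eq_zero, Finset.sum_eq_zero_iff_of_nonneg] at h
    · simpa [hxy] using h y (hS hy)
    · intro z _
      split_ifs with hz
      · by_cases hzS : z ∈ S
        · exact hc_nonneg z ((blockSetoid S X).trans hlx (blockSetoid_of_linked hx hzS hz))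
        · simp [c, hb0 z hzS, hv0 z hzS]
      · exact le_rfl
  have hiff : ∀ x y, blockSetoid S X x y → blockSetoid S X l x → (c x = 0 ↔ c y = 0) := by
    intro x y h
    induction h with
    | rel x y h =>
      intro hlx
      exact ⟨hspread x y h.1 h.2.1 h.2.2 hlx, hspread y x h.2.1 h.1 h.2.2.symm
        ((blockSetoid S X).trans hlx (blockSetoid_of_linked h.1 h.2.1 h.2.2))⟩
    | refl x => exact fun _ => Iff.rfl
    | symm x y h ih =>
      exact fun hly => (ih ((blockSetoid S X).trans hly ((blockSetoid S X).symm h))).symm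
    | trans x y z h _ ih ih' =>
      exact fun hlx => (ih hlx).trans (ih' ((blockSetoid S X).trans hlx h))
  have hci : c i = 0 := by
    simp only [c, hρ]
    field_simp [(hv i hiS).ne']
    ring
  have hcl : c l = 0 := (hiff l i hli ((blockSetoid S X).refl l)).2 hci
  have hcm : c m = 0 := (hiff l m hlm ((blockSetoid S X).refl l)).1 hcl
  rw [sub_eq_zero.1 hcl, sub_eq_zero.1 hcm]
  ring

open Classical in
/-- If the kernel of the incidence matrix contains a vector without zeros on `S`, and there are at
least two blocks, then there is a positive weight on `S` with total `1` on each block,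
with equal totals on all blocks at each point of `X`, and such that on each block all elements of
the kernel are proportional to it. -/
theorem exists_block_weight (hS : S ⊆ C.lines) (hX : X ⊆ C.points) {a : α → ℚ}
    (ha : a ∈ C.pointKernel S X) (haS : ∀ l ∈ S, a l ≠ 0)
    (htwo : ∃ l ∈ S, ∃ m ∈ S, ¬ blockSetoid S X l m) :
    ∃ u : α → ℚ, (∀ l ∈ S, 0 < u l) ∧
      (∀ l ∈ S, ∑ m ∈ S.filter (blockSetoid S X l), u m = 1) ∧
      (∀ p ∈ X, ∀ l ∈ S, ∀ m ∈ S, ∑ i ∈ p ∩ S.filter (blockSetoid S X l), u i =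
        ∑ i ∈ p ∩ S.filter (blockSetoid S X m), u i) ∧
      ∀ b ∈ C.pointKernel S X, ∀ l ∈ S, ∀ m, blockSetoid S X l m → b l * u m = b m * u l := by
  let r := blockSetoid S X
  let T : α → ℚ := fun l => ∑ m ∈ S.filter (r l), |a m|
  have hT : ∀ l ∈ S, 0 < T l := fun l hl => Finset.sum_pos
    (fun m hm => abs_pos.2 (haS m (Finset.mem_filter.1 hm).1))
    ⟨l, Finset.mem_filter.2 ⟨hl, r.refl l⟩⟩
  have hTr : ∀ l m, r l m → T l = T m := by
    intro l m h
    refine Finset.sum_congr (Finset.filter_congr fun i _ => ?_) fun _ _ => rfl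
    exact ⟨fun h' => r.trans (r.symm h) h', fun h' => r.trans h h'⟩
  -- For two blocks, the combination of the restrictions of `|a|` to them which has sum zero.
  let τ : α → α → α → ℚ := fun l m i => (if r l i then T m else 0) - if r m i then T l else 0
  have hτlink : ∀ l m, ∀ i ∈ S, ∀ j ∈ S, Linked X i j → τ l m i = τ l m j := by
    intro l m i hi j hj hij
    have h : r i j := blockSetoid_of_linked hi hj hij
    have h' : ∀ l, r l i ↔ r l j := fun l =>
      ⟨fun hl => r.trans hl h, fun hl => r.trans hl (r.symm h)⟩
    simp only [τ, h']
  have hsumS : ∀ (s : Finset α) (l : α) (c : ℚ),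
      ∑ i ∈ s, (if r l i then c else 0) * |a i| = c * ∑ i ∈ s ∩ S.filter (r l), |a i| := by
    intro s l c
    rw [Finset.mul_sum, ← Finset.sum_ite_mem]
    refine Finset.sum_congr rfl fun i _ => ?_
    by_cases hi : i ∈ S <;> by_cases hri : r l i <;> simp [hi, hri, ha.1 i]
  have hTC : ∀ l, ∑ i ∈ C.lines ∩ S.filter (r l), |a i| = T l := fun l => by
    rw [Finset.inter_eq_right.2 ((Finset.filter_subset _ _).trans hS)]
  have hker : ∀ l m, (fun i => τ l m i * |a i|) ∈ C.pointKernel S X := by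
    intro l m
    refine mul_abs_mem_pointKernel hX ha (hτlink l m) ?_
    simp only [τ, sub_mul, Finset.sum_sub_distrib, hsumS, hTC]
    ring
  have hother : ∀ l ∈ S, ∃ m ∈ S, ¬ r l m := by
    intro l hl
    obtain ⟨i, hi, j, hj, hij⟩ := htwo
    by_contra! h
    exact hij (r.trans (r.symm (h i hi)) (h j hj))
  have habs : ∀ l ∈ S, C.quadRow X (fun i => |a i|) l = 0 := by
    intro l hl
    obtain ⟨m, hm, hlm⟩ := hother l hl
    have h := quadRow_eq_zero hX (hker l m) (hS hl)
    rw [quadRow_mul_of_linked (hτlink l m) (fun i hi => by simp [ha.1 i hi]) hl] at h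
    have hτl : τ l m l = T m := by
      have h2 : ¬ r m l := fun h => hlm (r.symm h)
      simp [τ, h2]
    exact (mul_eq_zero.1 h).resolve_left (by rw [hτl]; exact (hT m hm).ne')
  have hsumu : ∀ (s : Finset α) (l : α), ∑ i ∈ s ∩ S.filter (r l), |a i| / T i =
      (∑ i ∈ s ∩ S.filter (r l), |a i|) / T l := by
    intro s l
    rw [Finset.sum_div]
    refine Finset.sum_congr rfl fun i hi => ?_
    rw [hTr l i (Finset.mem_filter.1 (Finset.mem_inter.1 hi).2).2]
  refine ⟨fun l => |a l| / T l, fun l hl => div_pos (abs_pos.2 (haS l hl)) (hT l hl),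
    fun l hl => ?_, fun p hp l hl m hm => ?_, fun b hb l hl m hlm => ?_⟩
  · have h := hsumu S l
    rw [Finset.inter_eq_right.2 (Finset.filter_subset _ _)] at h
    exact h.trans (div_self (hT l hl).ne')
  · refine (hsumu p l).trans (Eq.trans ?_ (hsumu p m).symm)
    rw [div_eq_div_iff (hT l hl).ne' (hT m hm).ne']
    have h := (hker l m).2.2 p hp
    simp only [τ, sub_mul, Finset.sum_sub_distrib, hsumS] at h
    linarith
  · have h := mul_eq_mul_of_quadRow_eq_zero hS (fun l hl => abs_pos.2 (haS l hl))
      (fun l hl => by simp [ha.1 l hl]) hb.1 habs (fun l hl => quadRow_eq_zero hX hb (hS hl)) hl hlm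
    change b l * (|a m| / T m) = b m * (|a l| / T l)
    rw [hTr l m hlm, ← mul_div_assoc, ← mul_div_assoc, h]

end LineCombinatorics

/-! ### Isotropic subspaces and the components of the resonance variety -/

namespace LineCombinatorics

variable {α : Type*} [DecidableEq α] (C : LineCombinatorics α)

/-- A subspace of the degree one part is isotropic if the product of any two of its elements in the
Orlik-Solomon algebra is zero. -/
def IsIsotropic (W : Submodule ℚ C.E₁) : Prop :=
  ∀ ω ∈ W, ∀ η ∈ W, C.osι ω * C.osι η = 0

open Classical in
/-- The lines whose coordinate does not vanish identically on `W`. -/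
noncomputable def supportLines (W : Submodule ℚ C.E₁) : Finset α :=
  C.lines.filter fun l => ∃ ω ∈ W, C.coord ω l ≠ 0

open Classical in
/-- The points `p` such that the restrictions to `p` of the elements of `W` span a space of
dimension at least two. -/
noncomputable def basePoints (W : Submodule ℚ C.E₁) : Finset (Finset α) :=
  C.points.filter fun p => ∃ ω ∈ W, ∃ η ∈ W, ∃ l ∈ p, ∃ m ∈ p,
    C.coord ω l * C.coord η m ≠ C.coord ω m * C.coord η l

/-- The largest subspace with support in `S` whose elements have sum zero over the points
of `X`. -/
noncomputable def kernelSubspace (S : Finset α) (X : Finset (Finset α)) : Submodule ℚ C.E₁ :=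
  (C.pointKernel S X).comap C.coord

variable {C} {W : Submodule ℚ C.E₁}

theorem supportLines_subset : C.supportLines W ⊆ C.lines := by
  classical exact Finset.filter_subset _ _

theorem basePoints_subset : C.basePoints W ⊆ C.points := by
  classical exact Finset.filter_subset _ _

theorem mem_supportLines {l : α} : l ∈ C.supportLines W ↔ ∃ ω ∈ W, C.coord ω l ≠ 0 := by
  classical
  rw [supportLines, Finset.mem_filter, and_iff_right_iff_imp]
  rintro ⟨ω, -, h⟩
  by_contra hl
  exact h (C.coord_apply_of_notMem ω hl)

theorem coord_eq_zero_of_notMem_supportLines {l : α} (hl : l ∉ C.supportLines W) {ω : C.E₁}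
    (hω : ω ∈ W) : C.coord ω l = 0 := by
  by_contra h
  exact hl (mem_supportLines.2 ⟨ω, hω, h⟩)

theorem mem_basePoints {p : Finset α} : p ∈ C.basePoints W ↔ p ∈ C.points ∧
    ∃ ω ∈ W, ∃ η ∈ W, ∃ l ∈ p, ∃ m ∈ p,
      C.coord ω l * C.coord η m ≠ C.coord ω m * C.coord η l := by
  classical rw [basePoints, Finset.mem_filter]

theorem IsIsotropic.mul_sum_eq (hW : C.IsIsotropic W) {ω η : C.E₁} (hω : ω ∈ W) (hη : η ∈ W)
    {p : Finset α} (hp : p ∈ C.points) {l : α} (hl : l ∈ p) :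
    C.coord ω l * ∑ m ∈ p, C.coord η m = C.coord η l * ∑ m ∈ p, C.coord ω m :=
  (C.osι_mul_osι_eq_zero_iff ω η).1 (hW ω hω η hη) p hp l hl

/-- If some element of `W` has nonzero sum over `p`, then all elements of `W` are proportional to it
at `p`. -/
theorem IsIsotropic.sum_basePoint (hW : C.IsIsotropic W) {p : Finset α} (hp : p ∈ C.basePoints W)
    {ω : C.E₁} (hω : ω ∈ W) : ∑ m ∈ p, C.coord ω m = 0 := by
  obtain ⟨hpC, η, hη, ζ, hζ, l, hl, m, hm, h⟩ := mem_basePoints.1 hp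
  by_contra h0
  have h1 := hW.mul_sum_eq hη hω hpC hl
  have h2 := hW.mul_sum_eq hη hω hpC hm
  have h3 := hW.mul_sum_eq hζ hω hpC hl
  have h4 := hW.mul_sum_eq hζ hω hpC hm
  rw [← eq_div_iff h0] at h1 h2 h3 h4
  apply h
  rw [h1, h2, h3, h4]
  ring

theorem IsIsotropic.coord_mem_pointKernel (hW : C.IsIsotropic W) {ω : C.E₁} (hω : ω ∈ W) :
    C.coord ω ∈ C.pointKernel (C.supportLines W) (C.basePoints W) :=
  ⟨fun _ hl => coord_eq_zero_of_notMem_supportLines hl hω, (C.coord_mem_sumZero ω).2,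
    fun _ hp => hW.sum_basePoint hp hω⟩

theorem IsIsotropic.le_kernelSubspace (hW : C.IsIsotropic W) :
    W ≤ C.kernelSubspace (C.supportLines W) (C.basePoints W) :=
  fun _ hω => hW.coord_mem_pointKernel hω

theorem coord_mul_coord_of_linked {l m : α} (hl : l ∈ C.lines) (hm : m ∈ C.lines)
    (hlm : Linked (C.basePoints W) l m) {ω η : C.E₁} (hω : ω ∈ W) (hη : η ∈ W) :
    C.coord ω l * C.coord η m = C.coord ω m * C.coord η l := by
  obtain ⟨p, ⟨hp, hlp, hmp⟩, -⟩ := C.existsUnique_point l hl m hm hlm.1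
  by_contra h
  exact hlm.2 p (mem_basePoints.2 ⟨hp, ω, hω, η, hη, l, hlp, m, hmp, h⟩) ⟨hlp, hmp⟩

/-- On a block, the coordinates of the elements of `W` are proportional to each other. -/
theorem coord_mul_coord_of_block {l m : α}
    (hlm : blockSetoid (C.supportLines W) (C.basePoints W) l m) :
    ∀ ω ∈ W, ∀ η ∈ W, C.coord ω l * C.coord η m = C.coord ω m * C.coord η l := by
  induction hlm with
  | rel x y h =>
    intro ω hω η hη
    exact coord_mul_coord_of_linked (supportLines_subset h.1) (supportLines_subset h.2.1) h.2.2
      hω hη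
  | refl x => exact fun _ _ _ _ => rfl
  | symm x y _ ih =>
    intro ω hω η hη
    linarith [ih ω hω η hη]
  | trans x y z hxy hyz ih ih' =>
    intro ω hω η hη
    by_cases hy : y ∈ C.supportLines W
    · obtain ⟨ζ, hζ, hζy⟩ := mem_supportLines.1 hy
      have h1 := ih ω hω ζ hζ
      have h2 := ih η hη ζ hζ
      have h3 := ih' ζ hζ ω hω
      have h4 := ih' ζ hζ η hη
      rw [← eq_div_iff hζy] at h1 h2
      rw [mul_comm, ← eq_div_iff hζy] at h3 h4
      rw [h1, h2, h3, h4]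
      ring
    · have hx : x ∉ C.supportLines W := fun h => hy ((blockSetoid_mem_iff hxy).1 h)
      have hz : z ∉ C.supportLines W := fun h => hy ((blockSetoid_mem_iff hyz).2 h)
      rw [coord_eq_zero_of_notMem_supportLines hx hω, coord_eq_zero_of_notMem_supportLines hz hω]
      ring

/-- A vector space over an infinite field is not a finite union of hyperplanes, so some element of
`W` has no zero coordinate on the support of `W`. -/
theorem exists_coord_ne_zero (W : Submodule ℚ C.E₁) :
    ∃ ω ∈ W, ∀ l ∈ C.supportLines W, C.coord ω l ≠ 0 := by
  obtain ⟨ω, hω, h⟩ := Module.Dual.exists_forall_mem_ne_zero_of_forall_exists W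
    (fun l : C.supportLines W => LinearMap.proj (l : α) ∘ₗ C.coord) fun l => mem_supportLines.1 l.2
  exact ⟨ω, hω, fun l hl => h ⟨l, hl⟩⟩

/-- If all lines of the support were in one block, all elements of `W` would be proportional. -/
theorem exists_not_block (hdim : 2 ≤ Module.finrank ℚ W) :
    ∃ l ∈ C.supportLines W, ∃ m ∈ C.supportLines W,
      ¬ blockSetoid (C.supportLines W) (C.basePoints W) l m := by
  by_contra! h
  obtain ⟨ω, hω, hω0⟩ := W.ne_bot_iff.1 (by
    rintro rfl
    rw [finrank_bot] at hdim
    omega)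
  obtain ⟨l, hl⟩ : ∃ l, C.coord ω l ≠ 0 := by
    by_contra! h0
    exact hω0 (C.coord_injective (by rw [map_zero]; exact funext h0))
  have hle : W ≤ Submodule.span ℚ {ω} := by
    intro η hη
    refine Submodule.mem_span_singleton.2 ⟨C.coord η l / C.coord ω l, C.coord_injective ?_⟩
    ext m
    rw [map_smul, Pi.smul_apply, smul_eq_mul, div_mul_eq_mul_div, div_eq_iff hl]
    by_cases hm : m ∈ C.supportLines W
    · exact (coord_mul_coord_of_block (h l (mem_supportLines.2 ⟨ω, hω, hl⟩) m hm) η hη ω hω)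
    · rw [coord_eq_zero_of_notMem_supportLines hm hω, coord_eq_zero_of_notMem_supportLines hm hη]
      ring
  have := (Submodule.finrank_mono hle).trans (finrank_span_le_card {ω})
  rw [Set.toFinset_singleton, Finset.card_singleton] at this
  omega

theorem IsIsotropic.isIsotropic_kernelSubspace (hW : C.IsIsotropic W)
    (hdim : 2 ≤ Module.finrank ℚ W) :
    C.IsIsotropic (C.kernelSubspace (C.supportLines W) (C.basePoints W)) := by
  obtain ⟨ω, hω, hne⟩ := exists_coord_ne_zero W
  obtain ⟨u, hu, -, -, hprop⟩ := exists_block_weight supportLines_subset basePoints_subset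
    (hW.coord_mem_pointKernel hω) hne (exists_not_block hdim)
  intro a ha b hb
  rw [osι_mul_osι_eq_zero_iff]
  intro p hp l hl
  by_cases hpX : p ∈ C.basePoints W
  · rw [ha.2.2 p hpX, hb.2.2 p hpX]
    ring
  rw [Finset.mul_sum, Finset.mul_sum]
  refine Finset.sum_congr rfl fun m hm => ?_
  by_cases hlS : l ∈ C.supportLines W
  swap
  · rw [ha.1 l hlS, hb.1 l hlS]
    ring
  by_cases hmS : m ∈ C.supportLines W
  swap
  · rw [ha.1 m hmS, hb.1 m hmS]
    ring
  have hlm : blockSetoid (C.supportLines W) (C.basePoints W) l m := by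
    by_cases h : l = m
    · exact h ▸ (blockSetoid _ _).refl l
    · refine blockSetoid_of_linked hlS hmS ⟨h, fun q hq hlq => hpX ?_⟩
      rwa [(C.existsUnique_point l (supportLines_subset hlS) m (supportLines_subset hmS) h).unique
        ⟨hp, hl, hm⟩ ⟨basePoints_subset hq, hlq⟩]
  have h1 := hprop _ ha l hlS m hlm
  have h2 := hprop _ hb l hlS m hlm
  have hul := (hu l hlS).ne'
  rw [eq_comm, ← eq_div_iff hul] at h1 h2
  rw [h1, h2]
  ring

theorem IsIsotropic.mono {W' : Submodule ℚ C.E₁} (hW : C.IsIsotropic W) (h : W' ≤ W) :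
    C.IsIsotropic W' :=
  fun ω hω η hη => hW ω (h hω) η (h hη)

variable (C) in
/-- Finitely many isotropic subspaces that contain all isotropic subspaces of dimension at least
two: they are determined by a set of lines and a set of points. The zero subspace is added. -/
def hulls : Set (Submodule ℚ C.E₁) :=
  {K | C.IsIsotropic K ∧
    (K = ⊥ ∨ 2 ≤ Module.finrank ℚ K ∧ ∃ S ⊆ C.lines, ∃ X ⊆ C.points, K = C.kernelSubspace S X)}

theorem finite_hulls : C.hulls.Finite := by
  refine Set.Finite.subset (((C.lines.powerset ×ˢ C.points.powerset).finite_toSet.image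
    fun SX => C.kernelSubspace SX.1 SX.2).insert ⊥) ?_
  rintro K ⟨-, rfl | ⟨-, S, hS, X, hX, rfl⟩⟩
  · exact Set.mem_insert _ _
  · refine Set.mem_insert_of_mem _ ⟨(S, X), ?_, rfl⟩
    simp [hS, hX]

theorem IsIsotropic.exists_hull (hW : C.IsIsotropic W) (hdim : 2 ≤ Module.finrank ℚ W) :
    ∃ K ∈ C.hulls, W ≤ K :=
  ⟨_, ⟨hW.isIsotropic_kernelSubspace hdim, Or.inr
    ⟨hdim.trans (Submodule.finrank_mono hW.le_kernelSubspace), _, supportLines_subset,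
      _, basePoints_subset, rfl⟩⟩, hW.le_kernelSubspace⟩

theorem mem_resonanceVariety_iff {ω : C.E₁} :
    ω ∈ C.resonanceVariety ↔ ∃ η, C.osι ω * C.osι η = 0 ∧ η ∉ Submodule.span ℚ {ω} := by
  change Nontrivial (C.HOne ω) ↔ _
  rw [Submodule.Quotient.nontrivial_iff, ne_eq, Submodule.eq_top_iff', not_forall]
  have hr : LinearMap.range (C.dZero ω) = Submodule.span ℚ {ω} :=
    LinearMap.range_toSpanSingleton ω
  constructor
  · rintro ⟨⟨η, hη⟩, h⟩
    exact ⟨η, hη, fun h' => h (by rw [hr]; exact h')⟩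
  · rintro ⟨η, hη, h⟩
    exact ⟨⟨η, hη⟩, fun h' => h (by rw [hr] at h'; exact h')⟩

theorem IsIsotropic.subset_resonanceVariety (hW : C.IsIsotropic W)
    (hdim : 2 ≤ Module.finrank ℚ W) : (W : Set C.E₁) ⊆ C.resonanceVariety := by
  intro ω hω
  rw [mem_resonanceVariety_iff]
  by_contra! h
  have hle : W ≤ Submodule.span ℚ {ω} := fun η hη => h η (hW ω hω η hη)
  have := (Submodule.finrank_mono hle).trans (finrank_span_le_card {ω})
  rw [Set.toFinset_singleton, Finset.card_singleton] at this
  omega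

theorem exists_hull_of_mem_resonanceVariety {ω : C.E₁} (hω : ω ∈ C.resonanceVariety) :
    ∃ K ∈ C.hulls, ω ∈ K := by
  by_cases h0 : ω = 0
  · subst h0
    refine ⟨⊥, ⟨fun a ha b hb => ?_, Or.inl rfl⟩, zero_mem _⟩
    rw [(Submodule.mem_bot ℚ).1 ha, map_zero, zero_mul]
  obtain ⟨η, hmul, hη⟩ := mem_resonanceVariety_iff.1 hω
  have hiso : C.IsIsotropic (Submodule.span ℚ {ω, η}) := by
    intro a ha b hb
    obtain ⟨s, t, rfl⟩ := Submodule.mem_span_pair.1 ha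
    obtain ⟨s', t', rfl⟩ := Submodule.mem_span_pair.1 hb
    have hmul' : C.osι η * C.osι ω = 0 := by rw [osι_mul_swap, hmul, neg_zero]
    simp only [map_add, map_smul, add_mul, mul_add, smul_mul_smul_comm, osι_mul_self, hmul, hmul',
      smul_zero, add_zero]
  have hli : LinearIndependent ℚ ![ω, η] := by
    rw [LinearIndependent.pair_iff' h0]
    exact fun c hc => hη (Submodule.mem_span_singleton.2 ⟨c, hc⟩)
  have hdim : 2 ≤ Module.finrank ℚ (Submodule.span ℚ {ω, η}) := by
    have h := finrank_span_eq_card hli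
    rw [Matrix.range_cons_cons_empty, Fintype.card_fin] at h
    exact h.ge
  obtain ⟨K, hK, hle⟩ := hiso.exists_hull hdim
  exact ⟨K, hK, hle (Submodule.subset_span (Set.mem_insert _ _))⟩

theorem exists_hull_of_isIrreducible {Y : Set C.E₁} (hY : Y ⊆ C.resonanceVariety)
    (hirr : @IsIrreducible C.E₁ (zariskiTopology ℚ C.E₁) Y) :
    ∃ K ∈ C.hulls, Y ⊆ K := by
  classical
  let _ : TopologicalSpace C.E₁ := zariskiTopology ℚ C.E₁
  let t : Finset (Set C.E₁) := (finite_hulls (C := C)).toFinset.image (↑)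
  have hmem : ∀ Z, Z ∈ t ↔ ∃ K ∈ C.hulls, (K : Set C.E₁) = Z := fun Z => by simp [t]
  have hclosed : ∀ Z ∈ t, IsClosed Z := by
    intro Z hZ
    obtain ⟨K, -, rfl⟩ := (hmem Z).1 hZ
    exact isClosed_submodule K
  have hcover : Y ⊆ ⋃₀ (t : Set (Set C.E₁)) := by
    intro ω hω
    obtain ⟨K, hK, hωK⟩ := exists_hull_of_mem_resonanceVariety (hY hω)
    exact ⟨K, Finset.mem_coe.2 ((hmem K).2 ⟨K, hK, rfl⟩), hωK⟩
  obtain ⟨Z, hZ, hYZ⟩ := isIrreducible_iff_sUnion_isClosed.1 hirr t hclosed hcover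
  obtain ⟨K, hK, rfl⟩ := (hmem Z).1 hZ
  exact ⟨K, hK, hYZ⟩

/-- The components of the resonance variety of dimension at least two are the maximal isotropic
subspaces of that dimension. -/
theorem isZariskiComponent_iff {k : ℕ} (hk : 2 ≤ k) {Z : Set C.E₁} :
    IsZariskiComponent ℚ C.resonanceVariety Z ∧ zariskiDim ℚ Z = k ↔
      ∃ W : Submodule ℚ C.E₁, Maximal C.IsIsotropic W ∧ Module.finrank ℚ W = k ∧ Z = W := by
  constructor
  · rintro ⟨hZ, hdim⟩
    obtain ⟨K, ⟨hK, h | ⟨hK2, -⟩⟩, hZK⟩ := exists_hull_of_isIrreducible hZ.prop.1 hZ.prop.2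
    · subst h
      have hZ0 : Z = ((⊥ : Submodule ℚ C.E₁) : Set C.E₁) := by
        refine subset_antisymm hZK ?_
        obtain ⟨z, hz⟩ := hZ.prop.2.1
        rintro _ rfl
        exact (hZK hz : z = 0) ▸ hz
      rw [hZ0, zariskiDim_submodule, finrank_bot] at hdim
      have : 0 = k := by exact_mod_cast hdim
      omega
    · obtain rfl : Z = K := subset_antisymm hZK
        (hZ.le_of_ge ⟨hK.subset_resonanceVariety hK2, isIrreducible_submodule K⟩ hZK)
      rw [zariskiDim_submodule] at hdim
      refine ⟨K, ⟨hK, fun W hW hKW => ?_⟩, by exact_mod_cast hdim, rfl⟩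
      exact hZ.le_of_ge ⟨hW.subset_resonanceVariety (hK2.trans (Submodule.finrank_mono hKW)),
        isIrreducible_submodule W⟩ hKW
  · rintro ⟨W, hW, hdim, rfl⟩
    refine ⟨⟨⟨hW.prop.subset_resonanceVariety (hk.trans_eq hdim.symm), isIrreducible_submodule W⟩,
      fun Y hY hWY => ?_⟩, by rw [zariskiDim_submodule, hdim]⟩
    obtain ⟨K, hK, hYK⟩ := exists_hull_of_isIrreducible hY.1 hY.2
    exact hYK.trans (hW.le_of_ge hK.1 (SetLike.coe_subset_coe.1 (hWY.trans hYK)))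

end LineCombinatorics

/-! ### Admissible maps and their row spaces -/

namespace LineCombinatorics

variable {α : Type*} [DecidableEq α] (C : LineCombinatorics α) {r : ℕ}

/-- The vector `f (e_l)` with rational entries; it is zero if `l` is not a line. -/
def imageVec (f : C.H →ₗ[ℤ] (Fin r → ℤ)) (l : α) : Fin r → ℚ :=
  if h : l ∈ C.lines then fun i => (f (C.e ⟨l, h⟩) i : ℚ) else 0

variable {C} in
theorem imageVec_coe (f : C.H →ₗ[ℤ] (Fin r → ℤ)) (l : C.lines) :
    C.imageVec f l = fun i => (f (C.e l) i : ℚ) :=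
  dif_pos l.2

variable {C} in
theorem imageVec_of_notMem (f : C.H →ₗ[ℤ] (Fin r → ℤ)) {l : α} (hl : l ∉ C.lines) :
    C.imageVec f l = 0 :=
  dif_neg hl

/-- The combination with coefficients `c` of the rows of the matrix with columns `f (e_l)`, as
a function of `l`. -/
def rowFun (f : C.H →ₗ[ℤ] (Fin r → ℤ)) : (Fin r → ℚ) →ₗ[ℚ] (α → ℚ) where
  toFun c l := c ⬝ᵥ C.imageVec f l
  map_add' c d := by
    ext l
    exact add_dotProduct c d _
  map_smul' t c := by
    ext l
    exact smul_dotProduct t c _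

/-- The linear map onto the row space of `f` given by the rows. -/
def rowMap (f : C.H →ₗ[ℤ] (Fin r → ℤ)) : (Fin r → ℚ) →ₗ[ℚ] C.E₁ :=
  C.ofFun ∘ₗ C.rowFun f

variable {C}

theorem rowFun_apply (f : C.H →ₗ[ℤ] (Fin r → ℤ)) (c : Fin r → ℚ) (l : α) :
    C.rowFun f c l = c ⬝ᵥ C.imageVec f l := rfl

theorem sum_imageVec (f : C.H →ₗ[ℤ] (Fin r → ℤ)) : ∑ l ∈ C.lines, C.imageVec f l = 0 := by
  have h : ∑ l : C.lines, C.e l = 0 := by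
    have h1 : (fun _ => 1 : C.lines → ℤ) = ∑ l, Pi.single l 1 := by
      ext m
      simp [Finset.sum_apply, Pi.single_apply]
    refine (map_sum (Submodule.mkQ _) (fun l : C.lines => Pi.single l (1 : ℤ)) _).symm.trans ?_
    rw [← h1, Submodule.mkQ_apply, Submodule.Quotient.mk_eq_zero]
    exact Submodule.mem_span_singleton_self _
  ext i
  rw [← Finset.sum_coe_sort C.lines]
  simp only [imageVec_coe, Finset.sum_apply, Pi.zero_apply]
  have h0 := congrFun (congrArg f h) i
  rw [map_sum, map_zero, Finset.sum_apply] at h0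
  exact_mod_cast h0

theorem rowFun_mem_sumZero (f : C.H →ₗ[ℤ] (Fin r → ℤ)) (c : Fin r → ℚ) :
    C.rowFun f c ∈ C.sumZero := by
  refine ⟨fun l hl => ?_, ?_⟩
  · rw [rowFun_apply, imageVec_of_notMem f hl, dotProduct_zero]
  · simp only [rowFun_apply]
    rw [← dotProduct_sum, sum_imageVec, dotProduct_zero]

theorem coord_rowMap (f : C.H →ₗ[ℤ] (Fin r → ℤ)) (c : Fin r → ℚ) :
    C.coord (C.rowMap f c) = C.rowFun f c :=
  C.coord_ofFun (rowFun_mem_sumZero f c)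

theorem range_rowMap (f : C.H →ₗ[ℤ] (Fin r → ℤ)) :
    LinearMap.range (C.rowMap f) = C.rowSpace f := by
  have h : ∀ i, C.rowMap f (Pi.single i 1) = ∑ l : C.lines, (f (C.e l) i : ℚ) • C.x l := by
    intro i
    refine (C.ofFun_eq_sum _).trans (Finset.sum_congr rfl fun l _ => ?_)
    rw [rowFun_apply, single_one_dotProduct, imageVec_coe]
  rw [rowSpace, ← funext h, LinearMap.range_eq_map, ← (Pi.basisFun ℚ (Fin r)).span_eq,
    Submodule.map_span, ← Set.range_comp]
  congr 2
  ext i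
  simp

theorem eq_sum_smul_e (h : C.H) : ∃ a : C.lines → ℤ, h = ∑ l, a l • C.e l := by
  obtain ⟨a, rfl⟩ := Submodule.Quotient.mk_surjective _ h
  refine ⟨a, ?_⟩
  have h1 : a = ∑ l, a l • Pi.single l (1 : ℤ) := by
    ext m
    simp [Finset.sum_apply, Pi.single_apply]
  change Submodule.mkQ _ a = _
  conv_lhs => rw [h1, map_sum]
  exact Finset.sum_congr rfl fun l _ => map_smul _ _ _

/-- The pairing of `c` with the value of `f` at an element of `H` is a combination of
the coordinates of the corresponding row vector. -/
theorem dotProduct_map_sum (f : C.H →ₗ[ℤ] (Fin r → ℤ)) (c : Fin r → ℚ) (a : C.lines → ℤ) :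
    (c ⬝ᵥ fun i => (f (∑ l, a l • C.e l) i : ℚ)) = ∑ l : C.lines, (a l : ℚ) * C.rowFun f c l := by
  have h : (fun i => (f (∑ l, a l • C.e l) i : ℚ)) =
      ∑ l : C.lines, (a l : ℚ) • C.imageVec f l := by
    ext i
    simp [Finset.sum_apply, imageVec_coe]
  rw [h, dotProduct_sum]
  simp only [dotProduct_smul, rowFun_apply, smul_eq_mul]

theorem rowMap_injective {f : C.H →ₗ[ℤ] (Fin r → ℤ)} (hf : Function.Surjective f) :
    Function.Injective (C.rowMap f) := by
  rw [injective_iff_map_eq_zero]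
  intro c hc
  ext i
  obtain ⟨h, hh⟩ := hf (Pi.single i 1)
  obtain ⟨a, rfl⟩ := eq_sum_smul_e h
  have h1 := dotProduct_map_sum f c a
  rw [hh, ← coord_rowMap, hc, map_zero] at h1
  have h2 : (fun j => ((Pi.single i (1 : ℤ) : Fin r → ℤ) j : ℚ)) = Pi.single i 1 := by
    ext j
    by_cases hij : j = i
    · subst hij
      simp
    · simp [hij]
  rw [h2, dotProduct_single_one] at h1
  simpa using h1

theorem finrank_rowSpace {f : C.H →ₗ[ℤ] (Fin r → ℤ)} (hf : Function.Surjective f) :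
    Module.finrank ℚ (C.rowSpace f) = r := by
  rw [← range_rowMap, LinearMap.finrank_range_of_inj (rowMap_injective hf), Module.finrank_fin_fun]

theorem not_linearIndependent_pair_int_iff (u v : Fin r → ℤ) :
    ¬ LinearIndependent ℤ ![u, v] ↔ ∀ i j, u i * v j = u j * v i := by
  rw [LinearIndependent.pair_iff]
  constructor
  · intro h i j
    by_contra hne
    refine h fun s t hst => ?_
    have hi := congrFun hst i
    have hj := congrFun hst j
    simp only [Pi.add_apply, Pi.smul_apply, smul_eq_mul, Pi.zero_apply] at hi hj
    have hne' : u i * v j - u j * v i ≠ 0 := sub_ne_zero.2 hne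
    constructor
    · refine (mul_eq_zero.1 (?_ : s * (u i * v j - u j * v i) = 0)).resolve_right hne'
      linear_combination v j * hi - v i * hj
    · refine (mul_eq_zero.1 (?_ : t * (u i * v j - u j * v i) = 0)).resolve_right hne'
      linear_combination u i * hj - u j * hi
  · intro h hli
    by_cases hu : u = 0
    · exact one_ne_zero (hli 1 0 (by simp [hu])).1
    · obtain ⟨i, hi⟩ := Function.ne_iff.1 hu
      refine hi (neg_eq_zero.1 (hli (v i) (-u i) ?_).2)
      ext j
      simp only [Pi.add_apply, Pi.smul_apply, smul_eq_mul, Pi.zero_apply]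
      linear_combination -h i j

/-- The dependency conditions in the definition of an admissible map are the local conditions
for two rows to have product zero in the Orlik-Solomon algebra. -/
theorem isAdmissible_iff {f : C.H →ₗ[ℤ] (Fin r → ℤ)} :
    C.IsAdmissible f ↔ 2 ≤ r ∧ Function.Surjective f ∧ C.IsIsotropic (C.rowSpace f) := by
  refine and_congr_right fun _ => and_congr_right fun _ => ?_
  have hsum : ∀ p ∈ C.points, ∀ i, (∑ m ∈ p, C.imageVec f m) i =
      ((∑ m ∈ Finset.univ.filter (fun m : C.lines => (m : α) ∈ p), f (C.e m)) i : ℤ) := by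
    intro p hp i
    have h1 : (∑ m ∈ p, C.imageVec f m) i =
        ∑ m ∈ C.lines, if m ∈ p then C.imageVec f m i else 0 := by
      rw [Finset.sum_ite_mem, Finset.inter_eq_right.2 (C.point_subset p hp), Finset.sum_apply]
    rw [h1, ← Finset.sum_coe_sort C.lines, Finset.sum_filter, Finset.sum_apply, Int.cast_sum]
    refine Finset.sum_congr rfl fun m _ => ?_
    split_ifs <;> simp [imageVec_coe]
  have hvec : ∀ (l : C.lines) i, C.imageVec f l i = f (C.e l) i := fun l i => by rw [imageVec_coe]
  have hrow : ∀ (p : Finset α) (c : Fin r → ℚ),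
      ∑ m ∈ p, C.rowFun f c m = c ⬝ᵥ ∑ m ∈ p, C.imageVec f m := fun p c => by
    rw [dotProduct_sum]
    rfl
  rw [← range_rowMap]
  constructor
  · rintro h _ ⟨c, rfl⟩ _ ⟨d, rfl⟩
    rw [osι_mul_osι_eq_zero_iff]
    intro p hp l hl
    have hd := (not_linearIndependent_pair_int_iff _ _).1
      (h p hp ⟨l, C.point_subset p hp hl⟩ hl)
    have hd' : ∀ i j, C.imageVec f l i * (∑ m ∈ p, C.imageVec f m) j =
        C.imageVec f l j * (∑ m ∈ p, C.imageVec f m) i := by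
      intro i j
      rw [hsum p hp, hsum p hp, hvec ⟨l, C.point_subset p hp hl⟩,
        hvec ⟨l, C.point_subset p hp hl⟩]
      exact_mod_cast hd i j
    rw [coord_rowMap, coord_rowMap, hrow, hrow, rowFun_apply, rowFun_apply]
    simp only [dotProduct, Finset.sum_mul_sum]
    rw [Finset.sum_comm]
    refine Finset.sum_congr rfl fun i _ => Finset.sum_congr rfl fun j _ => ?_
    linear_combination c j * d i * hd' j i
  · intro h p hp l hl
    rw [not_linearIndependent_pair_int_iff]
    intro i j
    have h1 := (C.osι_mul_osι_eq_zero_iff _ _).1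
      (h _ ⟨Pi.single i 1, rfl⟩ _ ⟨Pi.single j 1, rfl⟩) p hp l hl
    rw [coord_rowMap, coord_rowMap, hrow, hrow, rowFun_apply, rowFun_apply] at h1
    simp only [single_one_dotProduct, hsum p hp, hvec] at h1
    exact_mod_cast h1

/-- Every subspace is the row space of a surjective homomorphism: the image of `H` under the matrix
of a basis is a lattice, and coordinates are taken with respect to a basis of the lattice. -/
theorem exists_surjective_rowSpace_eq (W : Submodule ℚ C.E₁) (hW : Module.finrank ℚ W = r) :
    ∃ f : C.H →ₗ[ℤ] (Fin r → ℤ), Function.Surjective f ∧ C.rowSpace f = W := by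
  let b : Module.Basis (Fin r) ℚ W := Module.finBasisOfFinrankEq ℚ W hW
  let F : C.H →ₗ[ℤ] (Fin r → ℚ) := Submodule.liftQ _
    (Fintype.linearCombination ℤ fun (l : C.lines) i => C.coord (b i) l) (by
      rw [Submodule.span_singleton_le_iff_mem, LinearMap.mem_ker]
      ext i
      have h := (C.coord_mem_sumZero (b i)).2
      rw [← Finset.sum_coe_sort C.lines] at h
      simpa [Fintype.linearCombination_apply, Finset.sum_apply] using h)
  have hFe : ∀ l i, F (C.e l) i = C.coord (b i) l := by
    intro l i
    change Fintype.linearCombination ℤ (fun (l : C.lines) i => C.coord (b i) l)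
      (Pi.single l 1) i = _
    rw [Fintype.linearCombination_apply_single, one_smul]
  let M := LinearMap.range F
  let n := Module.finrank ℤ M
  let b' : Module.Basis (Fin n) ℤ M := Module.finBasis ℤ M
  have hli : LinearIndependent ℚ fun j => (b' j : Fin r → ℚ) := by
    rw [← LinearIndependent.iff_fractionRing ℤ ℚ]
    exact b'.linearIndependent.map' M.subtype M.ker_subtype
  let f : C.H →ₗ[ℤ] (Fin n → ℤ) := b'.equivFun.toLinearMap ∘ₗ F.rangeRestrict
  have hf : Function.Surjective f := b'.equivFun.surjective.comp F.surjective_rangeRestrict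
  have hFf : ∀ h, F h = ∑ j, (f h j : ℚ) • (b' j : Fin r → ℚ) := by
    intro h
    have h1 := congrArg M.subtype (b'.sum_equivFun (F.rangeRestrict h))
    rw [map_sum] at h1
    refine h1.symm.trans (Finset.sum_congr rfl fun j _ => ?_)
    rw [map_smul, ← Int.cast_smul_eq_zsmul ℚ]
    rfl
  have hle : W ≤ C.rowSpace f := by
    have hb : ∀ i, (b i : C.E₁) ∈ C.rowSpace f := by
      intro i
      rw [← range_rowMap]
      refine ⟨fun j => (b' j : Fin r → ℚ) i, C.coord_injective ?_⟩
      rw [coord_rowMap]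
      ext l
      by_cases hl : l ∈ C.lines
      · rw [rowFun_apply, imageVec_coe f ⟨l, hl⟩, ← hFe ⟨l, hl⟩ i, hFf]
        simp [dotProduct, Finset.sum_apply, mul_comm]
      · rw [rowFun_apply, imageVec_of_notMem f hl, dotProduct_zero, C.coord_apply_of_notMem _ hl]
    intro ω hω
    have h := b.sum_repr ⟨ω, hω⟩
    have h1 : ω = ∑ i, b.repr ⟨ω, hω⟩ i • (b i : C.E₁) := by
      have h' := congrArg W.subtype h
      rw [map_sum] at h'
      exact h'.symm
    rw [h1]
    exact Submodule.sum_mem _ fun i _ => Submodule.smul_mem _ _ (hb i)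
  have hn : n = r := by
    apply le_antisymm
    · simpa using hli.fintype_card_le_finrank
    · have := Submodule.finrank_mono hle
      rwa [hW, finrank_rowSpace hf] at this
  have heq : W = C.rowSpace f :=
    Submodule.eq_of_le_of_finrank_le hle (by rw [finrank_rowSpace hf, hW, hn])
  rw [← hn]
  exact ⟨f, hf, heq.symm⟩

/-- The rows of `f` are rational combinations of those of `g`, so they vanish where those of `g`
do. -/
theorem ker_le_ker_of_rowSpace_le {s : ℕ} {f : C.H →ₗ[ℤ] (Fin r → ℤ)}
    {g : C.H →ₗ[ℤ] (Fin s → ℤ)} (h : C.rowSpace f ≤ C.rowSpace g) :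
    LinearMap.ker g ≤ LinearMap.ker f := by
  intro z hz
  obtain ⟨a, rfl⟩ := eq_sum_smul_e z
  rw [LinearMap.mem_ker] at hz ⊢
  ext i
  obtain ⟨c, hc⟩ : C.rowMap f (Pi.single i 1) ∈ LinearMap.range (C.rowMap g) := by
    rw [range_rowMap]
    exact h (by rw [← range_rowMap]; exact ⟨_, rfl⟩)
  have h1 := dotProduct_map_sum f (Pi.single i 1) a
  have h2 := dotProduct_map_sum g c a
  rw [← coord_rowMap, ← hc, coord_rowMap, ← h2, single_one_dotProduct, hz] at h1
  have h3 : (c ⬝ᵥ fun i => ((0 : Fin s → ℤ) i : ℚ)) = 0 := by simp [dotProduct]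
  exact Int.cast_eq_zero.1 (h1.trans h3)

theorem rowSpace_comp_le {s : ℕ} (g : C.H →ₗ[ℤ] (Fin s → ℤ))
    (π : (Fin s → ℤ) →ₗ[ℤ] (Fin r → ℤ)) : C.rowSpace (π ∘ₗ g) ≤ C.rowSpace g := by
  rw [← range_rowMap, ← range_rowMap]
  rintro _ ⟨c, rfl⟩
  refine ⟨fun j => ∑ i, c i * π (Pi.single j 1) i, C.coord_injective ?_⟩
  rw [coord_rowMap, coord_rowMap]
  ext l
  by_cases hl : l ∈ C.lines
  · rw [rowFun_apply, rowFun_apply, imageVec_coe _ ⟨l, hl⟩, imageVec_coe _ ⟨l, hl⟩]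
    have h : ∀ i, ((π ∘ₗ g) (C.e ⟨l, hl⟩) i : ℚ) =
        ∑ j, (π (Pi.single j 1) i : ℚ) * (g (C.e ⟨l, hl⟩) j : ℚ) := by
      intro i
      have hg : g (C.e ⟨l, hl⟩) = ∑ j, g (C.e ⟨l, hl⟩) j • Pi.single j (1 : ℤ) := by
        ext m
        simp [Finset.sum_apply, Pi.single_apply]
      have hπ := congrFun (congrArg π hg) i
      rw [map_sum, Finset.sum_apply] at hπ
      rw [LinearMap.comp_apply, hπ, Int.cast_sum]
      refine Finset.sum_congr rfl fun j _ => ?_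
      rw [map_smul, Pi.smul_apply, smul_eq_mul, Int.cast_mul, mul_comm]
    simp only [dotProduct, h, Finset.mul_sum, Finset.sum_mul]
    rw [Finset.sum_comm]
    simp only [mul_assoc]
  · rw [rowFun_apply, rowFun_apply, imageVec_of_notMem _ hl, imageVec_of_notMem _ hl,
      dotProduct_zero, dotProduct_zero]

/-- A surjective homomorphism is a maximal admissible map if and only if its row space is a
maximal isotropic subspace. -/
theorem isMaximalAdmissible_iff (hr : 2 ≤ r) {f : C.H →ₗ[ℤ] (Fin r → ℤ)}
    (hf : Function.Surjective f) :
    C.IsMaximalAdmissible f ↔ Maximal C.IsIsotropic (C.rowSpace f) := by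
  constructor
  · rintro ⟨hadm, hmax⟩
    have hiso := (isAdmissible_iff.1 hadm).2.2
    refine ⟨hiso, fun W hW hle => ?_⟩
    by_contra hnle
    obtain ⟨η, hηW, hη⟩ := SetLike.not_le_iff_exists.1 hnle
    -- A row space that is one dimension larger gives an admissible map through which `f` factors.
    let W' := C.rowSpace f ⊔ Submodule.span ℚ {η}
    have hW'W : W' ≤ W := sup_le hle ((Submodule.span_singleton_le_iff_mem _ _).2 hηW)
    have hdim : Module.finrank ℚ W' = r + 1 := by
      rw [Submodule.finrank_sup_span_singleton hη, finrank_rowSpace hf]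
    obtain ⟨g, hg, hgW⟩ := exists_surjective_rowSpace_eq W' hdim
    have hker : LinearMap.ker g ≤ LinearMap.ker f :=
      ker_le_ker_of_rowSpace_le (hgW ▸ le_sup_left)
    obtain ⟨σ, hσ⟩ := Module.projective_lifting_property g LinearMap.id hg
    have hfg : ∀ h, f (σ (g h)) = f h := by
      intro h
      rw [← sub_eq_zero, ← map_sub]
      refine hker ?_
      rw [LinearMap.mem_ker, map_sub, sub_eq_zero]
      exact LinearMap.congr_fun hσ (g h)
    refine hmax ⟨g, f ∘ₗ σ, isAdmissible_iff.2 ⟨by omega, hg, hgW ▸ hW.mono hW'W⟩, fun y => ?_,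
      LinearMap.ext fun h => (hfg h).symm⟩
    obtain ⟨h, rfl⟩ := hf y
    exact ⟨g h, hfg h⟩
  · intro hmax
    refine ⟨isAdmissible_iff.2 ⟨hr, hf, hmax.prop⟩, ?_⟩
    rintro ⟨g, π, hg, -, rfl⟩
    obtain ⟨-, hg', hgiso⟩ := isAdmissible_iff.1 hg
    have h := Submodule.finrank_mono (hmax.le_of_ge hgiso (rowSpace_comp_le g π))
    rw [finrank_rowSpace hf, finrank_rowSpace hg'] at h
    omega

end LineCombinatorics

/-! ### The subspace of a pencil -/

namespace CombinatorialPencil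

variable {α : Type*} [DecidableEq α] (P : CombinatorialPencil α)

/-- The function that is the multiple `c F` of the weight on each fiber `F`. -/
def fiberMul : (P.fibers.parts → ℚ) →ₗ[ℚ] (α → ℚ) where
  toFun c l :=
    if h : l ∈ P.lines then c ⟨P.fibers.part l, P.fibers.part_mem.2 h⟩ * P.weight l else 0
  map_add' c d := by
    ext l
    by_cases h : l ∈ P.lines <;> simp [h, add_mul]
  map_smul' t c := by
    ext l
    by_cases h : l ∈ P.lines <;> simp [h, mul_assoc]

/-- The space of the functions that are multiples of the weight on each fiber, where the factors
of the fibers have sum zero. -/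
def space : Submodule ℚ (α → ℚ) :=
  (LinearMap.ker (∑ F, LinearMap.proj F : (P.fibers.parts → ℚ) →ₗ[ℚ] ℚ)).map P.fiberMul

variable {P}

theorem fiberMul_of_mem {F : Finset α} (hF : F ∈ P.fibers.parts) {l : α} (hl : l ∈ F)
    (c : P.fibers.parts → ℚ) : P.fiberMul c l = c ⟨F, hF⟩ * P.weight l := by
  have hlP : l ∈ P.lines := P.fibers.le hF hl
  change (if h : l ∈ P.lines then _ else _) = _
  rw [dif_pos hlP]
  congr 2
  exact Subtype.ext (P.fibers.part_eq_of_mem hF hl)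

theorem weight_ne_zero {l : α} (hl : l ∈ P.lines) : (P.weight l : ℚ) ≠ 0 :=
  Nat.cast_ne_zero.2 (P.weight_pos l hl).ne'

theorem mem_space_iff {a : α → ℚ} : a ∈ P.space ↔ (∀ l ∉ P.lines, a l = 0) ∧
    ∃ c : Finset α → ℚ, ∑ F ∈ P.fibers.parts, c F = 0 ∧
      ∀ F ∈ P.fibers.parts, ∀ l ∈ F, a l = c F * P.weight l := by
  constructor
  · rintro ⟨c, hc, rfl⟩
    refine ⟨fun l hl => dif_neg hl, fun F => if h : F ∈ P.fibers.parts then c ⟨F, h⟩ else 0, ?_, ?_⟩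
    · rw [← Finset.sum_coe_sort]
      simpa using hc
    · intro F hF l hl
      simp only [dif_pos hF]
      exact fiberMul_of_mem hF hl c
  · rintro ⟨h0, c, hc, h⟩
    refine ⟨fun F => c F, ?_, ?_⟩
    · rw [← Finset.sum_coe_sort] at hc
      simpa using hc
    · ext l
      by_cases hl : l ∈ P.lines
      · obtain ⟨F, hF, hlF⟩ := P.fibers.exists_mem hl
        rw [fiberMul_of_mem hF hlF, h F hF l hlF]
      · rw [h0 l hl]
        exact dif_neg hl

theorem fiberMul_injective : Function.Injective P.fiberMul := by
  rw [injective_iff_map_eq_zero]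
  intro c hc
  ext ⟨F, hF⟩
  obtain ⟨l, hl⟩ := P.fibers.nonempty_of_mem_parts hF
  have h := congrFun hc l
  rw [fiberMul_of_mem hF hl] at h
  exact (mul_eq_zero.1 h).resolve_right (weight_ne_zero (P.fibers.le hF hl))

theorem finrank_space_add_one (hP : P.fibers.parts.Nonempty) :
    Module.finrank ℚ P.space + 1 = P.fibers.parts.card := by
  let s : (P.fibers.parts → ℚ) →ₗ[ℚ] ℚ := ∑ F, LinearMap.proj F
  have hs : Function.Surjective s := by
    obtain ⟨F, hF⟩ := hP
    intro t
    exact ⟨Pi.single ⟨F, hF⟩ t, by simp [s]⟩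
  have h1 := LinearMap.finrank_range_add_finrank_ker s
  rw [LinearMap.range_eq_top.2 hs, finrank_top] at h1
  have h2 : Module.finrank ℚ P.space = Module.finrank ℚ (LinearMap.ker s) :=
    (Submodule.equivMapOfInjective _ fiberMul_injective _).finrank_eq.symm
  rw [h2, add_comm]
  simpa using h1

theorem exists_mem_space_of_fibers {F G : Finset α} (hF : F ∈ P.fibers.parts)
    (hG : G ∈ P.fibers.parts) (hFG : F ≠ G) :
    ∃ a ∈ P.space, (∀ l ∈ F, a l = P.weight l) ∧ (∀ l ∈ G, a l = - P.weight l) ∧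
      ∀ l, l ∉ F → l ∉ G → a l = 0 := by
  let c : P.fibers.parts → ℚ := Pi.single ⟨F, hF⟩ 1 - Pi.single ⟨G, hG⟩ 1
  have hne : (⟨F, hF⟩ : P.fibers.parts) ≠ ⟨G, hG⟩ := fun h => hFG (congrArg Subtype.val h)
  refine ⟨P.fiberMul c, ⟨c, ?_, rfl⟩, fun l hl => ?_, fun l hl => ?_, fun l hlF hlG => ?_⟩
  · simp [c]
  · rw [fiberMul_of_mem hF hl]
    simp [c, hne]
  · rw [fiberMul_of_mem hG hl]
    simp [c, hne.symm]
  · by_cases hl : l ∈ P.lines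
    · obtain ⟨K, hK, hlK⟩ := P.fibers.exists_mem hl
      have h1 : (⟨K, hK⟩ : P.fibers.parts) ≠ ⟨F, hF⟩ := fun h =>
        hlF ((Subtype.mk.inj h : K = F) ▸ hlK)
      have h2 : (⟨K, hK⟩ : P.fibers.parts) ≠ ⟨G, hG⟩ := fun h =>
        hlG ((Subtype.mk.inj h : K = G) ▸ hlK)
      rw [fiberMul_of_mem hK hlK]
      simp [c, h1, h2]
    · exact dif_neg hl

theorem mem_lines_iff_exists_mem_space (hP : 1 < P.fibers.parts.card) {l : α} :
    l ∈ P.lines ↔ ∃ a ∈ P.space, a l ≠ 0 := by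
  constructor
  · intro hl
    obtain ⟨F, hF, hlF⟩ := P.fibers.exists_mem hl
    obtain ⟨G, hG, hGF⟩ := Finset.exists_mem_ne hP F
    obtain ⟨a, ha, h, -, -⟩ := exists_mem_space_of_fibers hF hG hGF.symm
    exact ⟨a, ha, by rw [h l hlF]; exact weight_ne_zero hl⟩
  · rintro ⟨a, ha, h⟩
    by_contra hl
    exact h ((mem_space_iff.1 ha).1 l hl)

/-- Two lines are in the same fiber if and only if the coordinates at them are proportional on the
space of the pencil. This needs at least three fibers. -/
theorem mem_fiber_iff (hP : 2 < P.fibers.parts.card) {F : Finset α} (hF : F ∈ P.fibers.parts)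
    {l : α} (hl : l ∈ F) {m : α} :
    m ∈ F ↔ m ∈ P.lines ∧ ∀ a ∈ P.space, ∀ b ∈ P.space, a l * b m = a m * b l := by
  constructor
  · refine fun hm => ⟨P.fibers.le hF hm, fun a ha b hb => ?_⟩
    obtain ⟨-, c, -, hc⟩ := mem_space_iff.1 ha
    obtain ⟨-, d, -, hd⟩ := mem_space_iff.1 hb
    rw [hc F hF l hl, hc F hF m hm, hd F hF l hl, hd F hF m hm]
    ring
  · rintro ⟨hmP, h⟩
    obtain ⟨G, hG, hmG⟩ := P.fibers.exists_mem hmP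
    by_cases hFG : F = G
    · rwa [hFG]
    obtain ⟨K, hK, hKFG⟩ : ∃ K ∈ P.fibers.parts, K ∉ ({F, G} : Finset (Finset α)) :=
      Finset.exists_mem_notMem_of_card_lt_card (Finset.card_le_two.trans_lt hP)
    simp only [Finset.mem_insert, Finset.mem_singleton, not_or] at hKFG
    have hmF : m ∉ F := fun hmF => hFG (P.fibers.eq_of_mem_parts hF hG hmF hmG)
    have hmK : m ∉ K := fun hmK => hKFG.2 (P.fibers.eq_of_mem_parts hK hG hmK hmG)
    obtain ⟨a, ha, haF, -, ha0⟩ := exists_mem_space_of_fibers hF hK (Ne.symm hKFG.1)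
    obtain ⟨b, hb, -, hbG, -⟩ := exists_mem_space_of_fibers hF hG hFG
    have h1 := h a ha b hb
    rw [haF l hl, hbG m hmG, ha0 m hmF hmK, zero_mul] at h1
    have := mul_ne_zero (weight_ne_zero (P.fibers.le hF hl)) (neg_ne_zero.2 (weight_ne_zero hmP))
    exact absurd h1 this

theorem space_eq_of_smul_weight {P Q : CombinatorialPencil α} (hlines : P.lines = Q.lines)
    (hparts : P.fibers.parts = Q.fibers.parts) {t : ℚ} (ht : t ≠ 0)
    (h : ∀ l ∈ P.lines, (P.weight l : ℚ) = t * Q.weight l) : P.space = Q.space := by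
  ext a
  rw [mem_space_iff, mem_space_iff, ← hparts, ← hlines]
  refine and_congr_right fun _ => ⟨?_, ?_⟩
  · rintro ⟨c, hc, hac⟩
    refine ⟨fun F => c F * t, by rw [← Finset.sum_mul, hc, zero_mul], fun F hF l hl => ?_⟩
    rw [hac F hF l hl, h l (P.fibers.le hF hl), mul_assoc]
  · rintro ⟨c, hc, hac⟩
    refine ⟨fun F => c F * t⁻¹, by rw [← Finset.sum_mul, hc, zero_mul], fun F hF l hl => ?_⟩
    rw [hac F hF l hl, h l (P.fibers.le hF hl), mul_assoc, inv_mul_cancel_left₀ ht]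

theorem parts_subset_of_space_eq {P Q : CombinatorialPencil α} (hP : 2 < P.fibers.parts.card)
    (hQ : 2 < Q.fibers.parts.card) (hlines : P.lines = Q.lines) (h : P.space = Q.space) :
    P.fibers.parts ⊆ Q.fibers.parts := by
  intro F hF
  obtain ⟨l, hl⟩ := P.fibers.nonempty_of_mem_parts hF
  obtain ⟨G, hG, hlG⟩ := Q.fibers.exists_mem (hlines ▸ P.fibers.le hF hl)
  have hFG : F = G := by
    ext m
    rw [mem_fiber_iff hP hF hl, mem_fiber_iff hQ hG hlG, hlines, h]
  rwa [hFG]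

/-- A pencil with at least three fibers is determined by its space up to the scaling of the
weight. -/
theorem eq_of_space_eq {P Q : CombinatorialPencil α} (hP : 2 < P.fibers.parts.card)
    (hQ : 2 < Q.fibers.parts.card) (h : P.space = Q.space) :
    P.lines = Q.lines ∧ P.fibers.parts = Q.fibers.parts ∧
      ∃ c : ℚ, 0 < c ∧ ∀ l ∈ P.lines, (P.weight l : ℚ) = c * Q.weight l := by
  have hlines : P.lines = Q.lines := by
    ext l
    rw [mem_lines_iff_exists_mem_space (by omega), mem_lines_iff_exists_mem_space (by omega), h]
  have hparts : P.fibers.parts = Q.fibers.parts :=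
    (parts_subset_of_space_eq hP hQ hlines h).antisymm
      (parts_subset_of_space_eq hQ hP hlines.symm h.symm)
  refine ⟨hlines, hparts, ?_⟩
  have key : ∀ l ∈ P.lines, ∀ m ∈ P.lines,
      (P.weight l : ℚ) * Q.weight m = P.weight m * Q.weight l := by
    intro l hl m hm
    obtain ⟨F, hF, hlF⟩ := P.fibers.exists_mem hl
    by_cases hmF : m ∈ F
    · obtain ⟨G, hG, hGF⟩ := Finset.exists_mem_ne (show 1 < P.fibers.parts.card by omega) F
      obtain ⟨a, ha, haF, -, -⟩ := exists_mem_space_of_fibers hF hG hGF.symm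
      obtain ⟨-, c, -, hc⟩ := mem_space_iff.1 (h ▸ ha)
      have hl' := hc F (hparts ▸ hF) l hlF
      have hm' := hc F (hparts ▸ hF) m hmF
      rw [haF l hlF] at hl'
      rw [haF m hmF] at hm'
      rw [hl', hm']
      ring
    · obtain ⟨G, hG, hmG⟩ := P.fibers.exists_mem hm
      have hFG : F ≠ G := fun h => hmF (h ▸ hmG)
      obtain ⟨a, ha, haF, haG, ha0⟩ := exists_mem_space_of_fibers hF hG hFG
      obtain ⟨-, c, hsum, hc⟩ := mem_space_iff.1 (h ▸ ha)
      rw [← hparts] at hsum hc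
      have hc0 : ∀ K ∈ P.fibers.parts, K ≠ F ∧ K ≠ G → c K = 0 := by
        rintro K hK ⟨hKF, hKG⟩
        obtain ⟨n, hn⟩ := P.fibers.nonempty_of_mem_parts hK
        have h1 := hc K hK n hn
        rw [ha0 n (fun hnF => hKF (P.fibers.eq_of_mem_parts hK hF hn hnF))
          (fun hnG => hKG (P.fibers.eq_of_mem_parts hK hG hn hnG))] at h1
        exact (mul_eq_zero.1 h1.symm).resolve_right
          (weight_ne_zero (hlines ▸ P.fibers.le hK hn))
      rw [Finset.sum_eq_add_of_mem F G hF hG hFG hc0] at hsum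
      have hl' := hc F hF l hlF
      have hm' := hc G hG m hmG
      rw [haF l hlF] at hl'
      rw [haG m hmG] at hm'
      linear_combination Q.weight m * hl' + Q.weight l * hm' + Q.weight l * Q.weight m * hsum
  obtain ⟨F, hF⟩ : P.fibers.parts.Nonempty := Finset.card_pos.1 (by omega)
  obtain ⟨i, hi⟩ := P.fibers.nonempty_of_mem_parts hF
  have hiP := P.fibers.le hF hi
  have hiQ : i ∈ Q.lines := hlines ▸ hiP
  refine ⟨P.weight i / Q.weight i, div_pos (Nat.cast_pos.2 (P.weight_pos i hiP))
    (Nat.cast_pos.2 (Q.weight_pos i hiQ)), fun l hl => ?_⟩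
  rw [div_mul_eq_mul_div, eq_div_iff (weight_ne_zero hiQ)]
  exact key l hl i hiP

end CombinatorialPencil

namespace LineCombinatorics

variable {α : Type*} [DecidableEq α] {C : LineCombinatorics α} {k : ℕ}

/-- The row space of a map determined by a pencil depends only on the pencil. -/
theorem IsDeterminedBy.map_rowSpace {f : C.H →ₗ[ℤ] (Fin k → ℤ)} {P : CombinatorialPencil α}
    (hP : P.lines ⊆ C.lines) (h : C.IsDeterminedBy f P) :
    (C.rowSpace f).map C.coord = P.space := by
  obtain ⟨hcard, hf, v, hv, hfv, hf0⟩ := h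
  have hle : (C.rowSpace f).map C.coord ≤ P.space := by
    rw [← range_rowMap, Submodule.map_le_iff_le_comap]
    rintro _ ⟨c, rfl⟩
    rw [Submodule.mem_comap, coord_rowMap, CombinatorialPencil.mem_space_iff]
    have hrow : ∀ F ∈ P.fibers.parts, ∀ l : C.lines, (l : α) ∈ F →
        C.rowFun f c l = c ⬝ᵥ v F * P.weight l := by
      intro F hF l hl
      have h : C.imageVec f l = (P.weight l : ℚ) • v F := by
        ext i
        rw [imageVec_coe]
        exact hfv F hF l hl i
      rw [rowFun_apply, h, dotProduct_smul, smul_eq_mul, mul_comm]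
    refine ⟨fun l hl => ?_, fun F => c ⬝ᵥ v F, ?_, fun F hF l hl => ?_⟩
    · by_cases hlC : l ∈ C.lines
      · rw [rowFun_apply, imageVec_coe f ⟨l, hlC⟩, hf0 ⟨l, hlC⟩ hl]
        simp [dotProduct]
      · rw [rowFun_apply, imageVec_of_notMem f hlC, dotProduct_zero]
    · rw [← dotProduct_sum, hv, dotProduct_zero]
    · exact hrow F hF ⟨l, hP (P.fibers.le hF hl)⟩ hl
  have : Module.Finite ℚ P.space := Module.Finite.map _ _
  have h1 := CombinatorialPencil.finrank_space_add_one (P := P) (Finset.card_pos.1 (by omega))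
  refine Submodule.eq_of_le_of_finrank_le hle ?_
  rw [← (Submodule.equivMapOfInjective _ C.coord_injective _).finrank_eq, finrank_rowSpace hf]
  omega

theorem isDeterminedBy_of_map_rowSpace {f : C.H →ₗ[ℤ] (Fin k → ℤ)} {P : CombinatorialPencil α}
    (hf : Function.Surjective f) (hP : P.fibers.parts.Nonempty)
    (h : (C.rowSpace f).map C.coord = P.space) : C.IsDeterminedBy f P := by
  have hrow : ∀ i, C.rowFun f (Pi.single i 1) ∈ P.space := by
    intro i
    rw [← h, ← coord_rowMap, ← range_rowMap]
    exact Submodule.mem_map_of_mem ⟨_, rfl⟩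
  have hentry : ∀ (l : C.lines) i, (f (C.e l) i : ℚ) = C.rowFun f (Pi.single i 1) l := by
    intro l i
    rw [rowFun_apply, single_one_dotProduct, imageVec_coe]
  choose hzero c hc hfc using fun i => CombinatorialPencil.mem_space_iff.1 (hrow i)
  refine ⟨?_, hf, fun F i => c i F, ?_, fun F hF l hl i => ?_, fun l hl => ?_⟩
  · rw [← CombinatorialPencil.finrank_space_add_one hP, ← h,
      ← (Submodule.equivMapOfInjective _ C.coord_injective _).finrank_eq, finrank_rowSpace hf]
  · ext i
    rw [Finset.sum_apply]
    exact hc i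
  · rw [hentry, hfc i F hF l hl, mul_comm]
  · ext i
    have h0 := hentry l i
    rw [hzero i l hl] at h0
    exact_mod_cast h0

end LineCombinatorics

/-! ### The pencil of a maximal isotropic subspace -/

namespace LineCombinatorics

variable {α : Type*} [DecidableEq α] {C : LineCombinatorics α} {k : ℕ}

/-- The subcombinatorics on a subset of the lines. -/
def restrict (C : LineCombinatorics α) (S : Finset α) (hS : S ⊆ C.lines) :
    LineCombinatorics α where
  lines := S
  points := (C.points.image fun p => p ∩ S).filter fun q => 1 < q.card
  point_subset := by
    intro q hq
    obtain ⟨p, -, rfl⟩ := Finset.mem_image.1 (Finset.mem_filter.1 hq).1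
    exact Finset.inter_subset_right
  one_lt_card := fun q hq => (Finset.mem_filter.1 hq).2
  existsUnique_point := by
    intro i hi j hj hij
    obtain ⟨p, ⟨hp, hip, hjp⟩, hu⟩ := C.existsUnique_point i (hS hi) j (hS hj) hij
    have hi' : i ∈ p ∩ S := Finset.mem_inter.2 ⟨hip, hi⟩
    have hj' : j ∈ p ∩ S := Finset.mem_inter.2 ⟨hjp, hj⟩
    refine ⟨p ∩ S, ⟨Finset.mem_filter.2 ⟨Finset.mem_image_of_mem _ hp,
      Finset.one_lt_card.2 ⟨i, hi', j, hj', hij⟩⟩, hi', hj'⟩, ?_⟩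
    rintro q ⟨hq, hiq, hjq⟩
    obtain ⟨p', hp', rfl⟩ := Finset.mem_image.1 (Finset.mem_filter.1 hq).1
    rw [hu p' ⟨hp', Finset.mem_of_mem_inter_left hiq, Finset.mem_of_mem_inter_left hjq⟩]

/-- A positive rational function on a finite set is a multiple of a positive integral one. -/
theorem exists_nat_weight (S : Finset α) (u : α → ℚ) (hu : ∀ l ∈ S, 0 < u l) :
    ∃ (N : ℚ) (w : α → ℕ), 0 < N ∧ ∀ l ∈ S, (w l : ℚ) = N * u l := by
  refine ⟨∏ l ∈ S, ((u l).den : ℚ), fun l => (∏ m ∈ S.erase l, (u m).den) * (u l).num.toNat,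
    Finset.prod_pos fun l _ => Nat.cast_pos.2 (u l).den_pos, fun l hl => ?_⟩
  have hnum : ((u l).num.toNat : ℚ) = (u l).num := by
    exact_mod_cast Int.toNat_of_nonneg (Rat.num_nonneg.2 (hu l hl).le)
  rw [← Finset.mul_prod_erase S _ hl, Nat.cast_mul, Nat.cast_prod, hnum, ← Rat.mul_den_eq_num]
  ring

/-- Every maximal isotropic subspace of dimension at least two is the space of a pencil: its
fibers are the blocks, and its base points are the points at which the subspace has rank at least
two. -/
theorem exists_pencil_of_maximal {W : Submodule ℚ C.E₁} (hW : Maximal C.IsIsotropic W)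
    (hdim : 2 ≤ Module.finrank ℚ W) :
    ∃ P : CombinatorialPencil α, P.toLineCombinatorics.IsSubcombinatorics C ∧
      P.fibers.parts.Nonempty ∧ W.map C.coord = P.space := by
  classical
  set S := C.supportLines W
  set X := C.basePoints W
  have hS : S ⊆ C.lines := supportLines_subset
  have hX : X ⊆ C.points := basePoints_subset
  have hWK : W = C.kernelSubspace S X := le_antisymm hW.prop.le_kernelSubspace
    (hW.le_of_ge (hW.prop.isIsotropic_kernelSubspace hdim) hW.prop.le_kernelSubspace)
  obtain ⟨ω, hω, hne⟩ := exists_coord_ne_zero W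
  have htwo := exists_not_block hdim
  obtain ⟨u, hu, hsum, hbase, hprop⟩ := exists_block_weight hS hX
    (hW.prop.coord_mem_pointKernel hω) hne htwo
  obtain ⟨N, w, hN, hw⟩ := exists_nat_weight S u hu
  let fib : Finpartition S := Finpartition.ofSetSetoid (blockSetoid S X) S
  have hfib : ∀ F ∈ fib.parts, ∃ l ∈ S, F = S.filter (blockSetoid S X l) := by
    intro F hF
    obtain ⟨l, hl, rfl⟩ := Finset.mem_image.1 hF
    exact ⟨l, hl, rfl⟩
  have hfib' : ∀ l ∈ S, S.filter (blockSetoid S X l) ∈ fib.parts :=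
    fun l hl => Finset.mem_image_of_mem _ hl
  have hself : ∀ l ∈ S, l ∈ S.filter (blockSetoid S X l) :=
    fun l hl => Finset.mem_filter.2 ⟨hl, (blockSetoid S X).refl l⟩
  have hwsum : ∀ p F, F ∈ fib.parts → ∑ i ∈ p ∩ F, (w i : ℚ) = N * ∑ i ∈ p ∩ F, u i := by
    intro p F hF
    rw [Finset.mul_sum]
    exact Finset.sum_congr rfl fun i hi => hw i (fib.le hF (Finset.mem_of_mem_inter_right hi))
  have hbase' : ∀ p ∈ X, ∀ F ∈ fib.parts, ∀ G ∈ fib.parts,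
      ∑ i ∈ p ∩ F, u i = ∑ i ∈ p ∩ G, u i := by
    intro p hp F hF G hG
    obtain ⟨l, hl, rfl⟩ := hfib F hF
    obtain ⟨m, hm, rfl⟩ := hfib G hG
    exact hbase p hp l hl m hm
  have hinter : ∀ p F, F ∈ fib.parts → p ∩ S ∩ F = p ∩ F := by
    intro p F hF
    rw [Finset.inter_assoc, Finset.inter_eq_right.2 (fib.le hF)]
  have hother : ∀ F ∈ fib.parts, ∃ G ∈ fib.parts, F ≠ G := by
    obtain ⟨l, hl, m, hm, hlm⟩ := htwo
    intro F hF
    by_contra! h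
    have h1 := (h _ (hfib' l hl)).symm.trans (h _ (hfib' m hm))
    have h2 : m ∈ S.filter (blockSetoid S X l) := h1 ▸ hself m hm
    exact hlm (Finset.mem_filter.1 h2).2
  let P : CombinatorialPencil α :=
    { C.restrict S hS with
      fibers := fib
      weight := w
      weight_pos := fun l hl => by
        have h : (0 : ℚ) < w l := by
          rw [hw l hl]
          exact mul_pos hN (hu l hl)
        exact_mod_cast h
      fiber_or_base := by
        intro q hq
        obtain ⟨p, hp, rfl⟩ := Finset.mem_image.1 (Finset.mem_filter.1 hq).1
        have hcard : 1 < (p ∩ S).card := (Finset.mem_filter.1 hq).2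
        obtain ⟨i, hi⟩ : (p ∩ S).Nonempty := Finset.card_pos.1 (by omega)
        obtain ⟨hip, hiS⟩ := Finset.mem_inter.1 hi
        -- A point in a single fiber misses all other fibers, so the two cases exclude each other.
        have hexcl : ¬ ((∃ F ∈ fib.parts, p ∩ S ⊆ F) ∧
            ∀ F ∈ fib.parts, (p ∩ S ∩ F).Nonempty) := by
          rintro ⟨⟨F, hF, hpF⟩, hmeet⟩
          obtain ⟨G, hG, hFG⟩ := hother F hF
          obtain ⟨j, hj⟩ := hmeet G hG
          obtain ⟨hj, hjG⟩ := Finset.mem_inter.1 hj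
          exact hFG (fib.eq_of_mem_parts hF hG (hpF hj) hjG)
        by_cases hpX : p ∈ X
        · refine Or.inr ⟨?h, fun h => hexcl ⟨h, (?h : _ ∧ _).1⟩⟩
          have hpos : ∀ F ∈ fib.parts, 0 < ∑ l ∈ p ∩ F, u l := by
            intro F hF
            rw [hbase' p hpX F hF _ (hfib' i hiS)]
            refine Finset.sum_pos (fun l hl => hu l ?_) ⟨i, Finset.mem_inter.2 ⟨hip, hself i hiS⟩⟩
            exact (Finset.mem_filter.1 (Finset.mem_of_mem_inter_right hl)).1
          refine ⟨fun F hF => ?_, fun F hF G hG => ?_⟩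
          · rw [hinter p F hF]
            exact Finset.nonempty_of_sum_ne_zero (hpos F hF).ne'
          · have h := hbase' p hpX F hF G hG
            rw [hinter p F hF, hinter p G hG]
            have h' : ∑ i ∈ p ∩ F, (w i : ℚ) = ∑ i ∈ p ∩ G, (w i : ℚ) := by
              rw [hwsum p F hF, hwsum p G hG, h]
            exact_mod_cast h'
        · have h : ∃ F ∈ fib.parts, p ∩ S ⊆ F := by
            refine ⟨_, hfib' i hiS, fun j hj => ?_⟩
            obtain ⟨hjp, hjS⟩ := Finset.mem_inter.1 hj
            refine Finset.mem_filter.2 ⟨hjS, ?_⟩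
            by_cases hij : i = j
            · exact hij ▸ (blockSetoid S X).refl i
            · refine blockSetoid_of_linked hiS hjS ⟨hij, fun q hqX hq => hpX ?_⟩
              rwa [(C.existsUnique_point i (hS hiS) j (hS hjS) hij).unique
                ⟨hp, hip, hjp⟩ ⟨hX hqX, hq⟩]
          exact Or.inl ⟨h, fun h' => hexcl ⟨h, h'.1⟩⟩ }
  have hparts : ∀ g : α → ℚ, ∑ l ∈ S, g l = ∑ F ∈ fib.parts, ∑ l ∈ F, g l := by
    intro g
    conv_lhs => rw [← fib.biUnion_parts]
    exact Finset.sum_biUnion fib.disjoint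
  obtain ⟨i, hi, -⟩ := htwo
  refine ⟨P, ⟨hS, rfl⟩, ⟨_, hfib' i hi⟩, ?_⟩
  have hle : C.pointKernel S X ≤ LinearMap.range C.coord := fun a ha =>
    ⟨C.ofFun a, C.coord_ofFun ⟨fun l hl => ha.1 l fun hlS => hl (hS hlS), ha.2.1⟩⟩
  rw [hWK, kernelSubspace, Submodule.map_comap_eq_of_le hle]
  ext a
  rw [mem_pointKernel, CombinatorialPencil.mem_space_iff]
  refine and_congr_right fun h0 => ⟨?_, ?_⟩
  · rintro ⟨ha, haX⟩
    refine ⟨fun F => (∑ m ∈ F, a m) / N, ?_, fun F hF l hl => ?_⟩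
    · rw [← Finset.sum_div]
      refine div_eq_zero_iff.2 (Or.inl ((hparts _).symm.trans ?_))
      rw [← ha]
      exact Finset.sum_subset hS fun l _ hl => h0 l hl
    · obtain ⟨j, hj, rfl⟩ := hfib F hF
      obtain ⟨hlS, hjl⟩ := Finset.mem_filter.1 hl
      have h1 : (∑ m ∈ S.filter (blockSetoid S X j), a m) * u l = a l := by
        refine Eq.trans ?_ (mul_one (a l))
        rw [Finset.sum_mul, ← hsum j hj, Finset.mul_sum]
        refine Finset.sum_congr rfl fun m hm => ?_
        have hlm := (blockSetoid S X).trans ((blockSetoid S X).symm hjl)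
          (Finset.mem_filter.1 hm).2
        exact (hprop a ⟨h0, ha, haX⟩ l hlS m hlm).symm
      change _ = _ / N * (w l : ℚ)
      rw [hw l hlS, div_mul_eq_mul_div, ← h1]
      field_simp
  · rintro ⟨c, hc0, hc⟩
    -- The total of `a` over a set meeting all fibers with the same weight is a multiple of
    -- the sum of the factors `c F`.
    have hzero : ∀ p : Finset α,
        (∀ F ∈ fib.parts, ∑ l ∈ p ∩ F, u l = ∑ l ∈ p ∩ S.filter (blockSetoid S X i), u l) →
        ∑ l ∈ p, a l = 0 := by
      intro p hp
      have hF : ∀ F ∈ fib.parts, ∑ l ∈ F, (if l ∈ p then a l else 0) =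
          c F * (N * ∑ l ∈ p ∩ S.filter (blockSetoid S X i), u l) := by
        intro F hF
        rw [← hp F hF, ← hwsum p F hF, Finset.sum_ite_mem, Finset.inter_comm F p, Finset.mul_sum]
        exact Finset.sum_congr rfl fun l hl => hc F hF l (Finset.mem_of_mem_inter_right hl)
      have hS0 : ∑ l ∈ p, a l = ∑ l ∈ S, if l ∈ p then a l else 0 := by
        rw [Finset.sum_ite_mem]
        refine (Finset.sum_subset Finset.inter_subset_right fun l hlp hl => h0 l fun hlS => ?_).symm
        exact hl (Finset.mem_inter.2 ⟨hlS, hlp⟩)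
      rw [hS0, hparts, Finset.sum_congr rfl hF, ← Finset.sum_mul]
      exact mul_eq_zero_of_left hc0 _
    refine ⟨hzero _ fun F hF => ?_, fun p hp => hzero p fun F hF =>
      hbase' p hp F hF _ (hfib' i hi)⟩
    obtain ⟨j, hj, rfl⟩ := hfib F hF
    rw [Finset.inter_eq_right.2 ((Finset.filter_subset _ _).trans hS),
      Finset.inter_eq_right.2 ((Finset.filter_subset _ _).trans hS), hsum j hj, hsum i hi]

end LineCombinatorics

/-! ### The bijection -/

open LineCombinatorics in
theorem mainTheorem2 {α : Type*} [DecidableEq α] (C : LineCombinatorics α) (k : ℕ) (hk : 2 ≤ k) :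
    ∃ Φ : Quotient (C.pencilSetoid k) ≃ C.ResonanceComponent k,
      ∀ (P : C.MaximalPencil k) (f : C.H →ₗ[ℤ] (Fin k → ℤ)), C.IsDeterminedBy f P.1 →
        (Φ (Quotient.mk (C.pencilSetoid k) P)).1 = (C.rowSpace f : Set C.E₁) := by
  have hspace : ∀ (P : C.MaximalPencil k) (f : C.H →ₗ[ℤ] (Fin k → ℤ)), C.IsDeterminedBy f P.1 →
      P.1.space.comap C.coord = C.rowSpace f := fun P f hf => by
    rw [← hf.map_rowSpace P.2.1.1, Submodule.comap_map_eq_of_injective C.coord_injective]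
  have hmap : ∀ P : C.MaximalPencil k, (P.1.space.comap C.coord).map C.coord = P.1.space := by
    intro P
    obtain ⟨f, hf, -⟩ := P.2.2
    rw [hspace P f hf, hf.map_rowSpace P.2.1.1]
  have hcard : ∀ P : C.MaximalPencil k, 2 < P.1.fibers.parts.card := by
    intro P
    obtain ⟨f, hf, -⟩ := P.2.2
    rw [hf.1]
    omega
  have hcomp : ∀ P : C.MaximalPencil k,
      IsZariskiComponent ℚ C.resonanceVariety (P.1.space.comap C.coord : Set C.E₁) ∧
        zariskiDim ℚ (P.1.space.comap C.coord : Set C.E₁) = k := by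
    intro P
    obtain ⟨f, hf, hmax⟩ := P.2.2
    rw [isZariskiComponent_iff hk, hspace P f hf]
    exact ⟨_, (isMaximalAdmissible_iff hk hf.2.1).1 hmax, finrank_rowSpace hf.2.1, rfl⟩
  let φ : Quotient (C.pencilSetoid k) → C.ResonanceComponent k :=
    Quotient.lift (fun P => ⟨_, hcomp P⟩) (by
      rintro P Q ⟨h1, h2, c, hc, h⟩
      exact Subtype.ext (congrArg (fun V => (Submodule.comap C.coord V : Set C.E₁))
        (CombinatorialPencil.space_eq_of_smul_weight h1 h2 hc.ne' h)))
  have hφ : Function.Bijective φ := by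
    constructor
    · rintro ⟨P⟩ ⟨Q⟩ h
      refine Quotient.sound (CombinatorialPencil.eq_of_space_eq (hcard P) (hcard Q) ?_)
      have h' : P.1.space.comap C.coord = Q.1.space.comap C.coord :=
        SetLike.coe_injective (congrArg Subtype.val h)
      rw [← hmap P, ← hmap Q, h']
    · rintro ⟨Z, hZ⟩
      obtain ⟨W, hW, hdim, rfl⟩ := (isZariskiComponent_iff hk).1 hZ
      obtain ⟨P, hPC, hne, hPW⟩ := exists_pencil_of_maximal hW (hk.trans_eq hdim.symm)
      obtain ⟨f, hf, rfl⟩ := exists_surjective_rowSpace_eq W hdim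
      have hdet := isDeterminedBy_of_map_rowSpace hf hne hPW
      let Q : C.MaximalPencil k := ⟨P, hPC, f, hdet, (isMaximalAdmissible_iff hk hf).2 hW⟩
      exact ⟨Quotient.mk _ Q, Subtype.ext
        (congrArg (fun V : Submodule ℚ C.E₁ => (V : Set C.E₁)) (hspace Q f hdet))⟩
  exact ⟨Equiv.ofBijective φ hφ, fun P f hf =>
    congrArg (fun V : Submodule ℚ C.E₁ => (V : Set C.E₁)) (hspace P f hf)⟩
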